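/- Let $k$ be a field, $n\ge 0$, and let $\Lambda_n$ be the algebra of upper triangular $(n\times n)$-matrices over $k$, i.e. the path algebra of the quiver $1\leftarrow 2\leftarrow\cdots\leftarrow n$. Let $\operatorname{mod}\Lambda_n$ be the category of finitely generated left $\Lambda_n$-modules. For $1\le a<b\le n+1$ let $[a,b]$ denote the indecomposable $\Lambda_n$-module with composition factors $S(a),S(a+1),\dots,S(b-1)$, that is, $[a,b]=[1,b]/[1,a]$, where $[1,j+1]$ is the indecomposable projective module of length $j$ (and $[1,1]=0$). A full subcategory of $\operatorname{mod}\Lambda_n$ (closed under isomorphisms and containing $0$) is thick if it is closed under kernels, cokernels and extensions. A thick subcategory is exceptional if its quiver (vertices: isomorphism classes of its simple objects; an arrow $[T]\to[S]$ whenever $\operatorname{Ext}^1(T,S)\ne0$) has no oriented cyclic path. Let $\mathbf A(\operatorname{mod}\Lambda_n)$ be the poset of exceptional subcategories, ordered by inclusion. For a full subcategory $\mathcal A$ let $\mathcal A^\perp=\{U:\operatorname{Hom}(V,U)=0=\operatorname{Ext}^1(V,U)\ \forall V\in\mathcal A\}$ and ${}^\perp\mathcal A=\{V:\operatorname{Hom}(V,U)=0=\operatorname{Ext}^1(V,U)\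 \forall U\in\mathcal A\}$, both formed in $\operatorname{mod}\Lambda_n$. Let $\operatorname{NC}(n+1)$ be the poset of non-crossing partitions of $\{1,\dots,n+1\}$, where $P\le P'$ means that each part of $P$ is contained in a part of $P'$. The arcs of $P$ are the pairs $[a,b]$ of consecutive elements $a<b$ of a part of $P$. The coarcs of $P$ are the pairs $[a,z+1]$, where $a$ is the minimal and $z\le n$ the maximal element of the same part. Let $\mathcal A(P)$ be the full subcategory of all modules having a finite filtration whose factors are modules $[a,b]$ given by arcs of $P$. The Kreweras complement $\kappa(P)$ is the partition of $\{1,\dots,n+1\}$ generated by the pairs $[a-1,b]$, where $a>1$ is the minimal and $b$ the maximal element of the same part of $P$. Theorem. The map $P\mapsto\mathcal A(P)$ is an isomorphism of posets $\operatorname{NC}(n+1)\to\mathbf A(\operatorname{mod}\Lambda_n)$, and the simple objects of $\mathcal A(P)$ are, up to isomorphism, the modules given by the arcs of $P$. The map $\delta(\mathcal A)=\mathcal A^\perp$ is a poset anti-automorphism of $\mathbf A(\operatorname{mod}\Lambda_n)$, the Kreweras complement $\kappa$ maps $\operatorname{NC}(n+1)$ into itself, and for all $P\in\operatorname{NC}(n+1)$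 $$\delta(\mathcal A(P))=\mathcal A(P)^\perp=\mathcal A(\kappa(P)).$$ Thus $\delta$ and $\kappa$ correspond to each other under this identification. Moreover, the simple objects of ${}^\perp\mathcal A(P)$ are, up to isomorphism, the modules given by the coarcs of $P$. -/

import Mathlib

open CategoryTheory CategoryTheory.Limits

universe u

/-! ## Non-crossing partitions -/

/-- A partition of `{1 < 2 < ⋯ < m}` is encoded as an equivalence relation (a `Setoid`) on `Fin m`;
the parts are the equivalence classes, and the element `i` of `{1, …, m}` is `i - 1 : Fin m`.
It is non-crossing if `i < i' < j < j'` with `i, j` in one part and `i', j'` in one part implies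
that all four elements are in the same part. -/
def IsNoncrossing {m : ℕ} (P : Setoid (Fin m)) : Prop :=
  ∀ i i' j j' : Fin m, i < i' → i' < j → j < j' → P i j → P i' j' → P i i'

/-- The poset of non-crossing partitions of an `m`-element chain. As for all setoids, `P ≤ P'` means
that every part of `P` is contained in a part of `P'`. -/
abbrev NC (m : ℕ) : Type := {P : Setoid (Fin m) // IsNoncrossing P}

section Arcs

variable {m : ℕ} (P : Setoid (Fin m))

/-- `a` is the minimal element of its part. -/
def IsPartMin (a : Fin m) : Prop := ∀ c, P a c → a ≤ c

/-- `z` is the maximal element of its part. -/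
def IsPartMax (z : Fin m) : Prop := ∀ c, P z c → c ≤ z

/-- `[a, b]` is an arc of `P`: `a < b` are consecutive elements of one part. -/
def IsArc (a b : Fin m) : Prop := a < b ∧ P a b ∧ ∀ c, a < c → c < b → ¬ P a c

/-- `[a, b]` is a coarc of `P`: `b = z + 1` where `a` and `z` are the minimal and the maximal
element of the same part. -/
def IsCoarc (a b : Fin m) : Prop :=
  ∃ z : Fin m, P a z ∧ IsPartMin P a ∧ IsPartMax P z ∧ b.val = z.val + 1

/-- The pairs `[a - 1, b]`, where `a` (different from the first element) is the minimal element of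
a part and `b` is the maximal element of the same part. -/
def IsKrewerasArc (x b : Fin m) : Prop :=
  ∃ a : Fin m, P a b ∧ IsPartMin P a ∧ IsPartMax P b ∧ a.val = x.val + 1

/-- The Kreweras complement: the partition generated by the pairs `[a - 1, b]` above. -/
def krewerasComplement : Setoid (Fin m) := Relation.EqvGen.setoid (IsKrewerasArc P)

end Arcs

/-! ## Exceptional subcategories of `mod Λ`

Full subcategories of the category `mod Λ` of finitely generated left `Λ`-modules are given as
properties of objects of `ModuleCat Λ` which imply `ModuleCat.isFG`. -/

section Modules

variable {R : Type u} [Ring R]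

/-- A thick subcategory of `mod R`: it is closed under kernels, cokernels and extensions
(full subcategories are closed under isomorphisms and contain the zero objects). -/
structure IsThick (C : ObjectProperty (ModuleCat.{u} R)) : Prop where
  le_isFG : C ≤ ModuleCat.isFG R
  containsZero : C.ContainsZero
  isClosedUnderIsomorphisms : C.IsClosedUnderIsomorphisms
  isClosedUnderKernels : C.IsClosedUnderKernels
  isClosedUnderCokernels : C.IsClosedUnderCokernels
  isClosedUnderExtensions : C.IsClosedUnderExtensions

/-- `X` is a simple object of the category `C`. -/
def IsSimpleIn (C : ObjectProperty (ModuleCat.{u} R)) (X : ModuleCat.{u} R) : Prop :=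
  ∃ hX : C X, Simple (⟨X, hX⟩ : C.FullSubcategory)

/-- The arrows `[T] → [S]` of the quiver of `C`: the objects `T, S` are simple in `C`
and `Ext¹(T, S) ≠ 0`. -/
def QuiverArrow (C : ObjectProperty (ModuleCat.{u} R)) (T S : ModuleCat.{u} R) : Prop :=
  IsSimpleIn C T ∧ IsSimpleIn C S ∧ Nontrivial (Abelian.Ext.{u} T S 1)

/-- An exceptional subcategory of `mod R`: it is thick and its quiver has no oriented cyclic
path. -/
structure IsExceptional (C : ObjectProperty (ModuleCat.{u} R)) : Prop where
  isThick : IsThick C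
  acyclic : ∀ X, ¬ Relation.TransGen (QuiverArrow C) X X

variable (R) in
/-- The poset of exceptional subcategories of `mod R`, ordered by inclusion. -/
abbrev ExceptionalSubcategory : Type (u + 1) :=
  {C : ObjectProperty (ModuleCat.{u} R) // IsExceptional C}

/-- The right perpendicular category `C^⊥` in `mod R`: all `U` with `Hom(V, U) = 0 = Ext¹(V, U)` for
all `V` in `C`. -/
def rightPerp (C : ObjectProperty (ModuleCat.{u} R)) : ObjectProperty (ModuleCat.{u} R) := fun U =>
  ModuleCat.isFG R U ∧
    ∀ V, C V → Subsingleton (V ⟶ U) ∧ Subsingleton (Abelian.Ext.{u} V U 1)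

/-- The left perpendicular category `^⊥C` in `mod R`: all `V` with `Hom(V, U) = 0 = Ext¹(V, U)` for
all `U` in `C`. -/
def leftPerp (C : ObjectProperty (ModuleCat.{u} R)) : ObjectProperty (ModuleCat.{u} R) := fun V =>
  ModuleCat.isFG R V ∧
    ∀ U, C U → Subsingleton (V ⟶ U) ∧ Subsingleton (Abelian.Ext.{u} V U 1)

/-- The full subcategory of all modules having a finite filtration with factors in `A`. -/
inductive Filtered (A : ObjectProperty (ModuleCat.{u} R)) : ObjectProperty (ModuleCat.{u} R)
  | zero (M : ModuleCat.{u} R) (hM : IsZero M) : Filtered A M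
  | step (S : ShortComplex (ModuleCat.{u} R)) (hS : S.ShortExact) (h₁ : Filtered A S.X₁)
      (h₃ : A S.X₃) : Filtered A S.X₂

end Modules

/-! ## The algebra `Λ_n` and its indecomposable modules -/

section Algebra

variable (k : Type u) [Field k] (n : ℕ)

/-- The algebra `Λ_n` of upper triangular `n × n` matrices over `k`. This is the path algebra of
the quiver `1 ← 2 ← ⋯ ← n`: for `i ≤ j`, the matrix unit at `(i, j)` is the path from `j` to `i`. -/
def UpperTriangular : Type u := ↥(Matrix.blockTriangularSubalgebra k k (id : Fin n → Fin n))

noncomputable instance : Ring (UpperTriangular k n) :=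
  inferInstanceAs (Ring ↥(Matrix.blockTriangularSubalgebra k k (id : Fin n → Fin n)))

/-- The column space `kⁿ`, as a left module over the upper triangular matrices by matrix-vector
multiplication (this is the indecomposable projective module of length `n`). -/
def ColumnSpace : Type u := Fin n → k

noncomputable instance : AddCommGroup (ColumnSpace k n) :=
  inferInstanceAs (AddCommGroup (Fin n → k))

noncomputable instance : Module (UpperTriangular k n) (ColumnSpace k n) where
  smul M v := Matrix.mulVec M.1 v
  one_smul v := Matrix.one_mulVec v
  mul_smul M N v := (Matrix.mulVec_mulVec v M.1 N.1).symm
  smul_zero M := Matrix.mulVec_zero M.1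
  smul_add M v w := Matrix.mulVec_add M.1 v w
  add_smul M N v := Matrix.add_mulVec M.1 N.1 v
  zero_smul v := Matrix.zero_mulVec v

/-- The submodule of `kⁿ` of all vectors supported on the first `b` coordinates. For `b = j ≥ 1` it
is the indecomposable projective module of length `j`, denoted by `[1, j+1]`. -/
def initialSubmodule (b : Fin (n + 1)) : Submodule (UpperTriangular k n) (ColumnSpace k n) where
  carrier := {v | ∀ i : Fin n, b.val ≤ i.val → v i = 0}
  zero_mem' _ _ := rfl
  add_mem' {v w} hv hw i hi := by
    change v i + w i = 0
    rw [hv i hi, hw i hi, add_zero]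
  smul_mem' M v hv i hi := by
    change ∑ j, M.1 i j * v j = 0
    refine Finset.sum_eq_zero fun j _ => ?_
    rcases lt_or_ge j i with h | h
    · have h0 : M.1 i j = 0 := M.2 h
      rw [h0, zero_mul]
    · rw [hv j (hi.trans h), mul_zero]

/-- The interval module `[a, b]`, for `a < b` in a chain of `n + 1` elements: the factor module
`[1, b] / [1, a]`. Writing the chain as `{1, …, n + 1}`, its composition factors are the
simple modules `S(x)` with `a ≤ x ≤ b - 1`. -/
noncomputable def intervalModule (a b : Fin (n + 1)) : ModuleCat.{u} (UpperTriangular k n) :=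
  ModuleCat.of (UpperTriangular k n)
    (↥(initialSubmodule k n b) ⧸
      (initialSubmodule k n a).submoduleOf (initialSubmodule k n b))

variable {n} in
/-- The set of (isomorphism classes of) the interval modules `[a, b]` with `rel a b`. -/
def intervalModules (rel : Fin (n + 1) → Fin (n + 1) → Prop) :
    ObjectProperty (ModuleCat.{u} (UpperTriangular k n)) := fun X =>
  ∃ a b, rel a b ∧ Nonempty (X ≅ intervalModule k n a b)

end Algebra

/-! ## Combinatorics of the Kreweras complement -/

section Combinatorics

variable {m : ℕ}

/-! Everything is reduced to interval modules. In a nonzero module choose a path of maximal length,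
from `j` to `i`, that acts nontrivially, say on `m`. By maximality the interval module on the
vertices from `i` to `j` maps to the module through `m`, and a linear functional that is `1` on the
image of `m` under the path splits this map. So every finitely generated module is a finite direct
sum of interval modules, and a thick subcategory, being closed under summands, is determined by the
intervals in it. These form an equivalence relation on `{1, …, n + 1}` because of the sequences `0 →
[x, y] → [x, z] → [y, z] → 0`, and it is non-crossing because for `a < c < b < d` the canonical map
`[a, b] → [c, d]` has kernel `[a, c]`.

That `A(P)` is thick for every non-crossing `P` comes from duality. By the projective resolution `0
→ [1, a] → [1, b] → [a, b] → 0`, both `Hom` and `Ext¹` from `[a, b]` to `[c, d]` vanish if and only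
if `Hom([1, b], [c, d]) → Hom([1, a], [c, d])` is bijective. These spaces have dimension at most one
and the map is bijective when both are nonzero, so the condition says that the Euler form vanishes.
Perpendicular categories are therefore governed by the relations `rightDual` and `leftDual`, for
which `(c, d]`, respectively `[a, b)`, has to be a union of parts.

Since `A(P)` consists of modules of projective dimension at most one, its right perpendicular
category is thick, hence equal to `A(rightDual P)`. On non-crossing partitions the two duals are
mutually inverse, so `A(P)` is the right perpendicular category of `A(leftDual P)` and thereby
thick. Finally `rightDual` is the Kreweras complement, the arcs of `leftDual P` are the coarcs of
`P`, and thick subcategories are automatically exceptional: `Ext¹([a, b], [c, d]) ≠ 0` forces `c <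
a`, so arrows of the quiver strictly lower the left end point. -/

/-- The indicator of `c < x`, as an integer. -/
def ltIndicator (c x : Fin m) : ℤ := if c < x then 1 else 0

/-- The pairs `(a, b)` and `(c, d)` are orthogonal for the Euler form of the intervals. -/
def EulerOrthogonal (a b c d : Fin m) : Prop :=
  ltIndicator c a - ltIndicator c b = ltIndicator d a - ltIndicator d b

/-- `c ~ d` if the half-open interval between `c` and `d` (with the maximum included)
is a union of parts of `Q`. -/
def rightDual (Q : Setoid (Fin m)) : Setoid (Fin m) where
  r c d := ∀ a b, Q a b → EulerOrthogonal a b c d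
  iseqv :=
    { refl := fun _ _ _ _ => rfl
      symm := fun h a b hab => (h a b hab).symm
      trans := fun h h' a b hab => (h a b hab).trans (h' a b hab) }

/-- `a ~ b` if the half-open interval between `a` and `b` (with the minimum included)
is a union of parts of `P`. -/
def leftDual (P : Setoid (Fin m)) : Setoid (Fin m) where
  r a b := ∀ c d, P c d → EulerOrthogonal a b c d
  iseqv :=
    { refl := fun _ _ _ _ => by simp [EulerOrthogonal]
      symm := fun h c d hcd => by
        have := h c d hcd
        simp only [EulerOrthogonal] at this ⊢
        omega
      trans := fun h h' c d hcd => by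
        have h1 := h c d hcd
        have h2 := h' c d hcd
        simp only [EulerOrthogonal] at h1 h2 ⊢
        omega }

theorem rightDual_apply {Q : Setoid (Fin m)} {c d : Fin m} :
    rightDual Q c d ↔ ∀ a b, Q a b → EulerOrthogonal a b c d := Iff.rfl

theorem leftDual_apply {P : Setoid (Fin m)} {a b : Fin m} :
    leftDual P a b ↔ ∀ c d, P c d → EulerOrthogonal a b c d := Iff.rfl

/-- For `c ≤ d` the difference `ltIndicator c x - ltIndicator d x` is the indicator of `c < x ≤ d`;
the Euler condition says that it agrees at `a` and `b`. -/
theorem eulerOrthogonal_iff_right {a b c d : Fin m} (hcd : c ≤ d) :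
    EulerOrthogonal a b c d ↔ ((c < a ∧ a ≤ d) ↔ (c < b ∧ b ≤ d)) := by
  simp only [EulerOrthogonal, ltIndicator]
  split_ifs <;> simp <;> omega

/-- For `a ≤ b` the difference `ltIndicator x b - ltIndicator x a` is the indicator of `a ≤ x < b`;
the condition compares it at `c` and `d`. -/
theorem eulerOrthogonal_iff_left {a b c d : Fin m} (hab : a ≤ b) :
    EulerOrthogonal a b c d ↔ ((a ≤ c ∧ c < b) ↔ (a ≤ d ∧ d < b)) := by
  simp only [EulerOrthogonal, ltIndicator]
  split_ifs <;> simp <;> omega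

theorem rightDual_iff {Q : Setoid (Fin m)} {c d : Fin m} (hcd : c ≤ d) :
    rightDual Q c d ↔ ∀ a b, Q a b → c < a → a ≤ d → c < b ∧ b ≤ d := by
  rw [rightDual_apply]
  constructor
  · exact fun h a b hab h1 h2 => ((eulerOrthogonal_iff_right hcd).1 (h a b hab)).1 ⟨h1, h2⟩
  · exact fun h a b hab => (eulerOrthogonal_iff_right hcd).2
      ⟨fun h' => h a b hab h'.1 h'.2, fun h' => h b a (Q.symm hab) h'.1 h'.2⟩

theorem leftDual_iff {P : Setoid (Fin m)} {a b : Fin m} (hab : a ≤ b) :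
    leftDual P a b ↔ ∀ c d, P c d → a ≤ c → c < b → a ≤ d ∧ d < b := by
  rw [leftDual_apply]
  constructor
  · exact fun h c d hcd h1 h2 => ((eulerOrthogonal_iff_left hab).1 (h c d hcd)).1 ⟨h1, h2⟩
  · exact fun h c d hcd => (eulerOrthogonal_iff_left hab).2
      ⟨fun h' => h c d hcd h'.1 h'.2, fun h' => h d c (P.symm hcd) h'.1 h'.2⟩

/-- Unions of parts are closed under set difference, and `(c, c'] = (c, d] \ (c', d']` when `c < c'
< d < d'`. No assumption on `Q` is needed. -/
theorem isNoncrossing_rightDual (Q : Setoid (Fin m)) : IsNoncrossing (rightDual Q) := by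
  intro c c' d d' h1 h2 h3 hcd hcd'
  rw [rightDual_iff (by omega)] at hcd hcd' ⊢
  intro a b hab ha ha'
  have hb := hcd a b hab ha (by omega)
  refine ⟨hb.1, ?_⟩
  by_contra hlt
  have := hcd' b a ((Setoid.symm' _ hab)) (by omega) (by omega)
  omega

theorem isNoncrossing_leftDual (P : Setoid (Fin m)) : IsNoncrossing (leftDual P) := by
  intro c c' d d' h1 h2 h3 hcd hcd'
  rw [leftDual_iff (by omega)] at hcd hcd' ⊢
  intro a b hab ha ha'
  have hb := hcd a b hab ha (by omega)
  refine ⟨hb.1, ?_⟩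
  by_contra hlt
  have := hcd' b a ((Setoid.symm' _ hab)) (by omega) (by omega)
  omega

theorem exists_isPartMin (P : Setoid (Fin m)) (x : Fin m) : ∃ a, P x a ∧ IsPartMin P a := by
  classical
  have hne : (Finset.univ.filter fun a => P x a).Nonempty := ⟨x, by simp⟩
  have hmem := Finset.min'_mem _ hne
  refine ⟨_, (Finset.mem_filter.1 hmem).2, fun c hc => Finset.min'_le _ _ ?_⟩
  simpa using Setoid.trans' P (Finset.mem_filter.1 hmem).2 hc

theorem exists_isPartMax (P : Setoid (Fin m)) (x : Fin m) : ∃ a, P x a ∧ IsPartMax P a := by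
  classical
  have hne : (Finset.univ.filter fun a => P x a).Nonempty := ⟨x, by simp⟩
  have hmem := Finset.max'_mem _ hne
  refine ⟨_, (Finset.mem_filter.1 hmem).2, fun c hc => Finset.le_max' _ _ ?_⟩
  simpa using Setoid.trans' P (Finset.mem_filter.1 hmem).2 hc

/-- The interval spanned by a part of a non-crossing partition is a union of parts. -/
theorem IsNoncrossing.mem_span {P : Setoid (Fin m)} (hP : IsNoncrossing P) {a z : Fin m}
    (haz : P a z) (ha : IsPartMin P a) (hz : IsPartMax P z) {c d : Fin m} (hcd : P c d)
    (hac : a ≤ c) (hcz : c ≤ z) : a ≤ d ∧ d ≤ z := by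
  by_cases hca : P a c
  · have had := Setoid.trans' P hca hcd
    exact ⟨ha d had, hz d (Setoid.trans' P (Setoid.symm' P haz) had)⟩
  have hne : a ≠ c := fun h => hca (h ▸ Setoid.refl' P a)
  have hne' : c ≠ z := fun h => hca (h ▸ haz)
  by_contra hd
  rcases lt_or_ge d a with h | h
  · have := hP d a c z h (by omega) (by omega) (Setoid.symm' P hcd) haz
    exact hca (Setoid.trans' P (Setoid.symm' P this) (Setoid.symm' P hcd))
  · exact hca (hP a c z d (by omega) (by omega) (by omega) haz hcd)

theorem IsNoncrossing.rightDual_of_isKrewerasArc {P : Setoid (Fin m)} (hP : IsNoncrossing P)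
    {x b : Fin m} (h : IsKrewerasArc P x b) : rightDual P x b := by
  obtain ⟨a, hab, ha, hb, hx⟩ := h
  have hle : a ≤ b := ha b hab
  rw [rightDual_iff (by omega)]
  intro c d hcd h1 h2
  have := hP.mem_span hab ha hb hcd (by omega) h2
  omega

/-- Induction on the length of `(c, d]`. As `(c, d]` is a union of parts, `c + 1` is minimal in its
part; with `z` the maximum of that part, `[c, z]` is one of the generating pairs, and `(z, d]` is
again a union of parts. -/
theorem IsNoncrossing.krewerasComplement_of_saturated {P : Setoid (Fin m)} (hP : IsNoncrossing P)
    (l : ℕ) : ∀ c d : Fin m, c ≤ d → d.val = c.val + l → rightDual P c d →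
      krewerasComplement P c d := by
  induction l using Nat.strong_induction_on with
  | _ l ih =>
    intro c d hcd hl h
    rcases Nat.eq_zero_or_pos l with rfl | hpos
    · rw [show d = c from Fin.ext (by omega)]
    let a : Fin m := ⟨c + 1, by omega⟩
    have hac : a.val = c.val + 1 := rfl
    obtain ⟨z, haz, hz⟩ := exists_isPartMax P a
    have h' := (rightDual_iff hcd).1 h
    have hzd := h' a z haz (by omega) (by omega)
    have ha : IsPartMin P a := fun e he => by
      have := h' a e he (by omega) (by omega)
      omega
    have harc : IsKrewerasArc P c z := ⟨a, haz, ha, hz, hac⟩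
    have hcz : krewerasComplement P c z := Relation.EqvGen.rel _ _ harc
    refine Setoid.trans' _ hcz (ih (d.val - z.val) (by omega) z d hzd.2 (by omega) ?_)
    exact Setoid.trans' _ (Setoid.symm' _ (hP.rightDual_of_isKrewerasArc harc)) h

theorem IsNoncrossing.krewerasComplement_eq {P : Setoid (Fin m)} (hP : IsNoncrossing P) :
    krewerasComplement P = rightDual P := by
  apply le_antisymm
  · exact Setoid.eqvGen_le fun x b h => hP.rightDual_of_isKrewerasArc h
  · intro c d h
    rcases le_total c d with hcd | hcd
    · exact hP.krewerasComplement_of_saturated (d.val - c.val) c d hcd (by omega) h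
    · exact Setoid.symm' _ (hP.krewerasComplement_of_saturated (c.val - d.val) d c hcd (by omega)
        (Setoid.symm' _ h))

theorem le_leftDual_rightDual (P : Setoid (Fin m)) : P ≤ leftDual (rightDual P) :=
  fun {a b} hab _ _ hcd => hcd a b hab

theorem le_rightDual_leftDual (P : Setoid (Fin m)) : P ≤ rightDual (leftDual P) :=
  fun {c d} hcd _ _ hab => hab c d hcd

/-- The span of the part of `b` is a union of parts and corresponds to a pair in `rightDual P`.
Orthogonality to this pair puts `a`, and hence its whole part, into the span. Used in both
directions, this shows that the parts of `a` and `b` have the same minimum. -/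
theorem IsNoncrossing.partMin_le_of_leftDual_rightDual {P : Setoid (Fin m)}
    (hP : IsNoncrossing P) {a b x x' : Fin m} (hbx : P b x) (hx : IsPartMin P x) (hax' : P a x')
    (h : leftDual (rightDual P) a b) : x ≤ x' := by
  by_contra hlt
  obtain ⟨z, hxz, hz⟩ := exists_isPartMax P x
  have hxb : x ≤ b := hx b (Setoid.symm' P hbx)
  have hbz : b ≤ z := hz b (Setoid.symm' P (Setoid.trans' P hbx hxz))
  -- No truncation happens here: `x' < x` excludes `x = 0`.
  let y : Fin m := ⟨x - 1, by omega⟩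
  have hy : y.val = x.val - 1 := rfl
  have harc : IsKrewerasArc P y z := ⟨x, hxz, hx, hz, by omega⟩
  have := (eulerOrthogonal_iff_right (by omega)).1 (h y z (hP.rightDual_of_isKrewerasArc harc))
  have := hP.mem_span hxz hx hz hax' (by omega) (by omega)
  omega

theorem IsNoncrossing.leftDual_rightDual {P : Setoid (Fin m)} (hP : IsNoncrossing P) :
    leftDual (rightDual P) = P := by
  apply le_antisymm _ (le_leftDual_rightDual P)
  intro a b h
  obtain ⟨x, hbx, hx⟩ := exists_isPartMin P b
  obtain ⟨x', hax', hx'⟩ := exists_isPartMin P a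
  have h1 := hP.partMin_le_of_leftDual_rightDual hbx hx hax' h
  have h2 := hP.partMin_le_of_leftDual_rightDual hax' hx' hbx (Setoid.symm' _ h)
  obtain rfl := le_antisymm h1 h2
  exact Setoid.trans' P hax' (Setoid.symm' P hbx)

theorem IsNoncrossing.leftDual_of_isCoarc {P : Setoid (Fin m)} (hP : IsNoncrossing P)
    {a b : Fin m} (h : IsCoarc P a b) : leftDual P a b := by
  obtain ⟨z, haz, ha, hz, hb⟩ := h
  have := ha z haz
  rw [leftDual_iff (by omega)]
  intro c d hcd h1 h2
  have := hP.mem_span haz ha hz hcd h1 (by omega)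
  omega

theorem IsNoncrossing.le_partMax_of_rightDual_leftDual {P : Setoid (Fin m)}
    (hP : IsNoncrossing P) {c d z z' : Fin m} (hcz : P c z) (hz : IsPartMax P z) (hdz' : P d z')
    (h : rightDual (leftDual P) c d) : z' ≤ z := by
  by_contra hlt
  obtain ⟨x, hzx, hx⟩ := exists_isPartMin P z
  have hzc : c ≤ z := hz c (Setoid.symm' P hcz)
  have hxc : x ≤ c := hx c (Setoid.symm' P (Setoid.trans' P hcz hzx))
  -- This stays in range because `z < z'`.
  let y : Fin m := ⟨z + 1, by omega⟩
  have hy : y.val = z.val + 1 := rfl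
  have hxz := Setoid.symm' P hzx
  have := (eulerOrthogonal_iff_left (by omega)).1
    (h x y (hP.leftDual_of_isCoarc ⟨z, hxz, hx, hz, rfl⟩))
  have := hP.mem_span hxz hx hz hdz' (by omega) (by omega)
  omega

theorem IsNoncrossing.rightDual_leftDual {P : Setoid (Fin m)} (hP : IsNoncrossing P) :
    rightDual (leftDual P) = P := by
  apply le_antisymm _ (le_rightDual_leftDual P)
  intro c d h
  obtain ⟨z, hcz, hz⟩ := exists_isPartMax P c
  obtain ⟨z', hdz', hz'⟩ := exists_isPartMax P d
  have h1 := hP.le_partMax_of_rightDual_leftDual hcz hz hdz' h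
  have h2 := hP.le_partMax_of_rightDual_leftDual hdz' hz' hcz (Setoid.symm' _ h)
  obtain rfl := le_antisymm h1 h2
  exact Setoid.trans' P hcz (Setoid.symm' P hdz')

/-- If `[a, b)` is a union of parts, then `a` is the minimum of its part; with `z` its maximum, `[a,
z + 1)` is the smallest nonempty union of parts of the form `[a, c)`. Hence an arc of the dual
starting in `a` has to end in `z + 1`. -/
theorem IsNoncrossing.isArc_leftDual_iff {P : Setoid (Fin m)} (hP : IsNoncrossing P)
    {a b : Fin m} : IsArc (leftDual P) a b ↔ IsCoarc P a b := by
  constructor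
  · rintro ⟨hab, h, hc⟩
    have h' := (leftDual_iff hab.le).1 h
    obtain ⟨z, haz, hz⟩ := exists_isPartMax P a
    have hzb := h' a z haz le_rfl hab
    have ha : IsPartMin P a := fun e he => (h' a e he le_rfl hab).1
    refine ⟨z, haz, ha, hz, ?_⟩
    by_contra hne
    let y : Fin m := ⟨z + 1, by omega⟩
    have hy : y.val = z.val + 1 := rfl
    exact hc y (by omega) (by omega) (hP.leftDual_of_isCoarc ⟨z, haz, ha, hz, rfl⟩)
  · intro h
    have hl := hP.leftDual_of_isCoarc h
    obtain ⟨z, haz, ha, hz, hb⟩ := h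
    have := ha z haz
    refine ⟨by omega, hl, fun c hac hcb h => ?_⟩
    have := (leftDual_iff hac.le).1 h a z haz le_rfl hac
    omega

theorem leftDual_anti {P P' : Setoid (Fin m)} (h : P ≤ P') : leftDual P' ≤ leftDual P :=
  fun {_ _} hab c d hcd => hab c d (h hcd)

theorem rightDual_anti {P P' : Setoid (Fin m)} (h : P ≤ P') : rightDual P' ≤ rightDual P :=
  fun {_ _} hcd a b hab => hcd a b (h hab)

/-- The Kreweras complement as an anti-automorphism of the lattice of non-crossing partitions. -/
def rightDualOrderIso (m : ℕ) : NC m ≃o (NC m)ᵒᵈ where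
  toFun P := OrderDual.toDual ⟨rightDual P.1, isNoncrossing_rightDual P.1⟩
  invFun P := ⟨leftDual (OrderDual.ofDual P).1, isNoncrossing_leftDual _⟩
  left_inv P := Subtype.ext P.2.leftDual_rightDual
  right_inv P := congrArg OrderDual.toDual (Subtype.ext (OrderDual.ofDual P).2.rightDual_leftDual)
  map_rel_iff' {P P'} := by
    constructor
    · intro h
      have h' : leftDual (rightDual P.1) ≤ leftDual (rightDual P'.1) := leftDual_anti h
      rw [P.2.leftDual_rightDual, P'.2.leftDual_rightDual] at h'
      exact h'
    · exact fun h => rightDual_anti (P := P.1) (P' := P'.1) h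

/-- `a < b` are related for a non-crossing partition: then some arc ends in `b`. -/
theorem exists_isArc {P : Setoid (Fin m)} {a b : Fin m} (hab : a < b) (h : P a b) :
    ∃ x, a ≤ x ∧ IsArc P x b ∧ P a x := by
  classical
  have hne : (Finset.univ.filter fun x => a ≤ x ∧ x < b ∧ P a x).Nonempty :=
    ⟨a, by simp [hab]⟩
  have hmem := (Finset.mem_filter.1 (Finset.max'_mem _ hne)).2
  refine ⟨_, hmem.1, ⟨hmem.2.1, Setoid.trans' P (Setoid.symm' P hmem.2.2) h,
    fun c hc hcb hPc => ?_⟩, hmem.2.2⟩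
  refine hc.not_ge (Finset.le_max' _ _ ?_)
  exact Finset.mem_filter.2 ⟨Finset.mem_univ _, hmem.1.trans hc.le, hcb,
    Setoid.trans' P hmem.2.2 hPc⟩

end Combinatorics

/-! ## Orthogonality with respect to `Hom` and `Ext¹` -/

section Orthogonality

open Abelian

universe w v

variable {C : Type*} [Category.{v} C] [Abelian C] [HasExt.{w} C]

/-- `Hom(V, U) = 0 = Ext¹(V, U)`. -/
def ExtOrthogonal (V U : C) : Prop := Subsingleton (V ⟶ U) ∧ Subsingleton (Ext.{w} V U 1)

theorem subsingleton_ext_zero_iff (V U : C) :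
    Subsingleton (Ext.{w} V U 0) ↔ Subsingleton (V ⟶ U) :=
  Ext.homEquiv₀.subsingleton_congr

/-- Writing `Hom` as `Ext⁰` makes the long exact sequence arguments uniform in the degree. -/
theorem extOrthogonal_iff (V U : C) :
    ExtOrthogonal V U ↔ Subsingleton (Ext.{w} V U 0) ∧ Subsingleton (Ext.{w} V U 1) := by
  rw [subsingleton_ext_zero_iff, ExtOrthogonal]

theorem subsingleton_ext_biprod_left_iff (X Y U : C) (i : ℕ) :
    Subsingleton (Ext.{w} (X ⊞ Y) U i) ↔
      Subsingleton (Ext.{w} X U i) ∧ Subsingleton (Ext.{w} Y U i) := by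
  rw [Ext.biprodAddEquiv.toEquiv.subsingleton_congr]
  exact ⟨fun _ => ⟨(Prod.fst_surjective (β := Ext Y U i)).subsingleton,
    (Prod.snd_surjective (α := Ext X U i)).subsingleton⟩, fun ⟨_, _⟩ => inferInstance⟩

theorem extOrthogonal_biprod_left_iff (X Y U : C) :
    ExtOrthogonal (X ⊞ Y) U ↔ ExtOrthogonal X U ∧ ExtOrthogonal Y U := by
  simp only [extOrthogonal_iff, subsingleton_ext_biprod_left_iff]
  tauto

theorem subsingleton_ext_of_iso_left {X Y : C} (e : X ≅ Y) (U : C) (i : ℕ)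
    [Subsingleton (Ext.{w} X U i)] : Subsingleton (Ext.{w} Y U i) := by
  refine subsingleton_of_forall_eq 0 fun x => ?_
  rw [← Ext.mk₀_id_comp x, ← e.inv_hom_id, ← Ext.mk₀_comp_mk₀_assoc,
    Subsingleton.elim ((Ext.mk₀ e.hom).comp x _) 0, Ext.comp_zero]

theorem subsingleton_ext_of_iso_right {X Y : C} (e : X ≅ Y) (V : C) (i : ℕ)
    [Subsingleton (Ext.{w} V X i)] : Subsingleton (Ext.{w} V Y i) := by
  refine subsingleton_of_forall_eq 0 fun x => ?_
  rw [← Ext.comp_mk₀_id x, ← e.inv_hom_id, ← Ext.mk₀_comp_mk₀,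
    ← Ext.comp_assoc_of_second_deg_zero,
    Subsingleton.elim (x.comp (Ext.mk₀ e.inv) _) 0, Ext.zero_comp]

theorem ExtOrthogonal.of_iso_left {X Y U : C} (h : ExtOrthogonal X U) (e : X ≅ Y) :
    ExtOrthogonal Y U := by
  rw [extOrthogonal_iff] at h ⊢
  have := h.1
  have := h.2
  exact ⟨subsingleton_ext_of_iso_left e U 0, subsingleton_ext_of_iso_left e U 1⟩

theorem ExtOrthogonal.of_iso_right {X Y V : C} (h : ExtOrthogonal V X) (e : X ≅ Y) :
    ExtOrthogonal V Y := by
  rw [extOrthogonal_iff] at h ⊢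
  have := h.1
  have := h.2
  exact ⟨subsingleton_ext_of_iso_right e V 0, subsingleton_ext_of_iso_right e V 1⟩

theorem extOrthogonal_of_isZero_left {X : C} (hX : IsZero X) (U : C) : ExtOrthogonal X U := by
  rw [extOrthogonal_iff]
  have (i : ℕ) : Subsingleton (Ext.{w} X U i) := subsingleton_of_forall_eq 0 fun x => by
    rw [← Ext.mk₀_id_comp x, hX.eq_of_src (𝟙 X) 0, Ext.mk₀_zero, Ext.zero_comp]
  exact ⟨this 0, this 1⟩

theorem extOrthogonal_of_isZero_right {X : C} (hX : IsZero X) (V : C) : ExtOrthogonal V X := by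
  rw [extOrthogonal_iff]
  have (i : ℕ) : Subsingleton (Ext.{w} V X i) := subsingleton_of_forall_eq 0 fun x => by
    rw [← Ext.comp_mk₀_id x, hX.eq_of_src (𝟙 X) 0, Ext.mk₀_zero, Ext.comp_zero]
  exact ⟨this 0, this 1⟩

variable {S : ShortComplex C}

theorem subsingleton_ext_X₁ (hS : S.ShortExact) (V : C) (i : ℕ) [Subsingleton (Ext.{w} V S.X₃ i)]
    [Subsingleton (Ext.{w} V S.X₂ (i + 1))] : Subsingleton (Ext.{w} V S.X₁ (i + 1)) := by
  refine subsingleton_of_forall_eq 0 fun x => ?_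
  obtain ⟨y, rfl⟩ := Ext.covariant_sequence_exact₁ V hS x (Subsingleton.elim _ _) rfl
  rw [Subsingleton.elim y 0, Ext.zero_comp]

theorem subsingleton_ext_zero_X₁ (hS : S.ShortExact) (V : C) [Subsingleton (Ext.{w} V S.X₂ 0)] :
    Subsingleton (Ext.{w} V S.X₁ 0) := by
  have := hS.mono_f
  exact (Ext.postcomp_mk₀_injective_of_mono V S.f).subsingleton

theorem subsingleton_ext_X₂ (hS : S.ShortExact) (V : C) (i : ℕ) [Subsingleton (Ext.{w} V S.X₁ i)]
    [Subsingleton (Ext.{w} V S.X₃ i)] : Subsingleton (Ext.{w} V S.X₂ i) := by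
  refine subsingleton_of_forall_eq 0 fun x => ?_
  obtain ⟨y, rfl⟩ := Ext.covariant_sequence_exact₂ V hS x (Subsingleton.elim _ _)
  rw [Subsingleton.elim y 0, Ext.zero_comp]

theorem subsingleton_ext_X₂_left (hS : S.ShortExact) (U : C) (i : ℕ)
    [Subsingleton (Ext.{w} S.X₁ U i)] [Subsingleton (Ext.{w} S.X₃ U i)] :
    Subsingleton (Ext.{w} S.X₂ U i) := by
  refine subsingleton_of_forall_eq 0 fun x => ?_
  obtain ⟨y, rfl⟩ := Ext.contravariant_sequence_exact₂ hS U x (Subsingleton.elim _ _)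
  rw [Subsingleton.elim y 0, Ext.comp_zero]

theorem subsingleton_ext_X₃ (hS : S.ShortExact) (V : C) (i : ℕ) [Subsingleton (Ext.{w} V S.X₂ i)]
    [Subsingleton (Ext.{w} V S.X₁ (i + 1))] : Subsingleton (Ext.{w} V S.X₃ i) := by
  refine subsingleton_of_forall_eq 0 fun x => ?_
  obtain ⟨y, rfl⟩ := Ext.covariant_sequence_exact₃ V hS x rfl (Subsingleton.elim _ _)
  rw [Subsingleton.elim y 0, Ext.zero_comp]

/-- Orthogonality to the cokernel of a monomorphism into a projective object. -/
theorem extOrthogonal_X₃_iff_of_projective (hS : S.ShortExact) [Projective S.X₂] (U : C) :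
    ExtOrthogonal S.X₃ U ↔ Function.Bijective fun φ : S.X₂ ⟶ U => S.f ≫ φ := by
  have := hS.epi_g
  constructor
  · rintro ⟨_, _⟩
    constructor
    · intro φ ψ h
      have h0 : S.f ≫ (φ - ψ) = 0 := by
        rw [Preadditive.comp_sub]
        exact sub_eq_zero.2 h
      rw [← sub_eq_zero, ← hS.exact.g_desc (φ - ψ) h0,
        Subsingleton.elim (hS.exact.desc (φ - ψ) h0) 0, comp_zero]
    · intro φ
      obtain ⟨x, hx⟩ := Ext.contravariant_sequence_exact₁ hS U (Ext.mk₀ φ) rfl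
        (Subsingleton.elim _ _)
      obtain ⟨ψ, rfl⟩ := Ext.homEquiv₀.symm.surjective x
      refine ⟨ψ, Ext.homEquiv₀.symm.injective ?_⟩
      simpa using hx
  · rintro ⟨hi, hs⟩
    constructor
    · refine subsingleton_of_forall_eq 0 fun φ => ?_
      rw [← cancel_epi S.g, comp_zero]
      apply hi
      simp
    · refine subsingleton_of_forall_eq 0 fun x => ?_
      obtain ⟨y, rfl⟩ := Ext.contravariant_sequence_exact₃ hS U x
        (Ext.eq_zero_of_projective _) (n₀ := 0) rfl
      obtain ⟨φ, rfl⟩ := Ext.homEquiv₀.symm.surjective y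
      obtain ⟨ψ, rfl⟩ := hs φ
      change hS.extClass.comp (Ext.mk₀ (S.f ≫ ψ)) _ = 0
      rw [← Ext.mk₀_comp_mk₀, hS.extClass_comp_assoc]

end Orthogonality

/-! ### Thick and perpendicular subcategories over a general ring -/

section Thick

variable {R : Type u} [Ring R]

theorem shortExact_kernel_image {C : Type*} [Category* C] [Abelian C] {X Y : C} (f : X ⟶ Y) :
    (ShortComplex.mk (kernel.ι f) (factorThruImage f)
      (by rw [← cancel_mono (image.ι f)]; simp)).ShortExact where
  exact := ShortComplex.exact_of_f_is_kernel _
    (isKernelOfComp (image.ι f) f (kernelIsKernel f) _ (image.fac f))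

theorem shortExact_image_cokernel {C : Type*} [Category* C] [Abelian C] {X Y : C} (f : X ⟶ Y) :
    (ShortComplex.mk (image.ι f) (cokernel.π f)
      (by rw [← cancel_epi (factorThruImage f)]; simp)).ShortExact where
  exact := ShortComplex.exact_of_g_is_cokernel _
    (isCokernelOfComp (factorThruImage f) f (cokernelIsCokernel f) _ (image.fac f))

theorem rightPerp_iff (C : ObjectProperty (ModuleCat.{u} R)) (U : ModuleCat.{u} R) :
    rightPerp C U ↔ ModuleCat.isFG R U ∧ ∀ V, C V → ExtOrthogonal.{u} V U := Iff.rfl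

theorem leftPerp_iff (C : ObjectProperty (ModuleCat.{u} R)) (V : ModuleCat.{u} R) :
    leftPerp C V ↔ ModuleCat.isFG R V ∧ ∀ U, C U → ExtOrthogonal.{u} V U := Iff.rfl

theorem isFG_of_iso {X Y : ModuleCat.{u} R} (e : X ≅ Y) (h : ModuleCat.isFG R X) :
    ModuleCat.isFG R Y := by
  rw [ModuleCat.isFG_iff] at h ⊢
  exact Module.Finite.equiv e.toLinearEquiv

theorem isFG_of_epi {X Y : ModuleCat.{u} R} (f : X ⟶ Y) [Epi f] (h : ModuleCat.isFG R X) :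
    ModuleCat.isFG R Y := by
  rw [ModuleCat.isFG_iff] at h ⊢
  exact Module.Finite.of_surjective f.hom ((ModuleCat.epi_iff_surjective f).1 ‹_›)

theorem isFG_of_mono [IsNoetherianRing R] {X Y : ModuleCat.{u} R} (f : X ⟶ Y) [Mono f]
    (h : ModuleCat.isFG R Y) : ModuleCat.isFG R X := by
  rw [ModuleCat.isFG_iff] at h ⊢
  have : IsNoetherian R Y := isNoetherian_of_isNoetherianRing_of_finite R Y
  exact Module.Finite.of_injective f.hom ((ModuleCat.mono_iff_injective f).1 ‹_›)

theorem isFG_of_isZero {X : ModuleCat.{u} R} (h : IsZero X) : ModuleCat.isFG R X := by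
  have := ModuleCat.subsingleton_of_isZero h
  rw [ModuleCat.isFG_iff]
  infer_instance

theorem isFG_of_shortExact {S : ShortComplex (ModuleCat.{u} R)} (hS : S.ShortExact)
    (h₁ : ModuleCat.isFG R S.X₁) (h₃ : ModuleCat.isFG R S.X₃) : ModuleCat.isFG R S.X₂ := by
  rw [ModuleCat.isFG_iff] at h₁ h₃ ⊢
  have hr := hS.exact.moduleCat_range_eq_ker
  have h1 : Module.Finite R (LinearMap.range S.f.hom) := inferInstance
  rw [Module.Finite.iff_fg] at h1
  have hs := (ModuleCat.epi_iff_surjective S.g).1 hS.epi_g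
  refine ⟨Submodule.fg_of_fg_map_of_fg_inf_ker S.g.hom ?_ ?_⟩
  · rw [Submodule.map_top, LinearMap.range_eq_top.2 hs]
    exact h₃.fg_top
  · rw [top_inf_eq, ← hr]
    exact h1

theorem rightPerp_of_iso {C : ObjectProperty (ModuleCat.{u} R)} {X Y : ModuleCat.{u} R}
    (e : X ≅ Y) (h : rightPerp C X) : rightPerp C Y :=
  ⟨isFG_of_iso e h.1, fun V hV => ExtOrthogonal.of_iso_right (h.2 V hV) e⟩

theorem leftPerp_of_iso {C : ObjectProperty (ModuleCat.{u} R)} {X Y : ModuleCat.{u} R}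
    (e : X ≅ Y) (h : leftPerp C X) : leftPerp C Y :=
  ⟨isFG_of_iso e h.1, fun V hV => ExtOrthogonal.of_iso_left (h.2 V hV) e⟩

/-- Right perpendicular categories of objects of projective dimension at most `1` are thick. -/
theorem isThick_rightPerp [IsNoetherianRing R] {C : ObjectProperty (ModuleCat.{u} R)}
    (hC : ∀ V, C V → HasProjectiveDimensionLT V 2) : IsThick (rightPerp C) := by
  -- As a subobject of `Y` the image receives no maps from `V`; as a quotient of `X` by the kernel
  -- it has no `Ext¹` from `V`, since `Ext²(V, kernel f) = 0`.
  have image_mem {X Y : ModuleCat.{u} R} (f : X ⟶ Y) (hX : rightPerp C X) (hY : rightPerp C Y)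
      (V : ModuleCat.{u} R) (hV : C V) : ExtOrthogonal.{u} V (image f) := by
    have h1 := (extOrthogonal_iff V X).1 (hX.2 V hV)
    have h2 := (extOrthogonal_iff V Y).1 (hY.2 V hV)
    have := h1.2
    have := h2.1
    have := hC V hV
    have := HasProjectiveDimensionLT.subsingleton.{u} V 2 2 le_rfl (kernel f)
    exact (extOrthogonal_iff _ _).2 ⟨subsingleton_ext_zero_X₁ (shortExact_image_cokernel f) V,
      subsingleton_ext_X₃ (shortExact_kernel_image f) V 1⟩
  constructor
  · exact fun U hU => hU.1
  · have hZ := isZero_zero (ModuleCat.{u} R)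
    exact ⟨_, hZ, isFG_of_isZero hZ, fun V _ => extOrthogonal_of_isZero_right hZ V⟩
  · exact ⟨fun e h => rightPerp_of_iso e h⟩
  · refine ⟨fun K hK => ?_⟩
    obtain ⟨f, k, hk, hX, hY⟩ := hK
    refine rightPerp_of_iso ((kernelIsKernel f).conePointUniqueUpToIso hk) ?_
    refine ⟨isFG_of_mono (kernel.ι f) hX.1, fun V hV => ?_⟩
    have h1 := (extOrthogonal_iff V _).1 (hX.2 V hV)
    have h2 := (extOrthogonal_iff V _).1 (image_mem f hX hY V hV)
    have := h1.1
    have := h1.2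
    have := h2.1
    exact (extOrthogonal_iff _ _).2 ⟨subsingleton_ext_zero_X₁ (shortExact_kernel_image f) V,
      subsingleton_ext_X₁ (shortExact_kernel_image f) V 0⟩
  · refine ⟨fun K hK => ?_⟩
    obtain ⟨f, k, hk, hX, hY⟩ := hK
    refine rightPerp_of_iso ((cokernelIsCokernel f).coconePointUniqueUpToIso hk) ?_
    refine ⟨isFG_of_epi (cokernel.π f) hY.1, fun V hV => ?_⟩
    have h1 := (extOrthogonal_iff V _).1 (hY.2 V hV)
    have h2 := (extOrthogonal_iff V _).1 (image_mem f hX hY V hV)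
    have := h1.1
    have := h1.2
    have := h2.2
    have := hC V hV
    have := HasProjectiveDimensionLT.subsingleton.{u} V 2 2 le_rfl (image f)
    exact (extOrthogonal_iff _ _).2 ⟨subsingleton_ext_X₃ (shortExact_image_cokernel f) V 0,
      subsingleton_ext_X₃ (shortExact_image_cokernel f) V 1⟩
  · refine ⟨fun {S} hS h₁ h₃ => ⟨isFG_of_shortExact hS h₁.1 h₃.1, fun V hV => ?_⟩⟩
    have h1 := (extOrthogonal_iff V _).1 (h₁.2 V hV)
    have h3 := (extOrthogonal_iff V _).1 (h₃.2 V hV)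
    have := h1.1
    have := h1.2
    have := h3.1
    have := h3.2
    exact (extOrthogonal_iff _ _).2 ⟨subsingleton_ext_X₂ hS V 0, subsingleton_ext_X₂ hS V 1⟩

variable {C : ObjectProperty (ModuleCat.{u} R)}

theorem IsThick.of_iso (hC : IsThick C) {X Y : ModuleCat.{u} R} (e : X ≅ Y) (h : C X) : C Y :=
  hC.isClosedUnderIsomorphisms.of_iso e h

theorem IsThick.of_isZero (hC : IsThick C) {X : ModuleCat.{u} R} (h : IsZero X) : C X := by
  obtain ⟨Z, hZ, hCZ⟩ := hC.containsZero.exists_zero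
  exact hC.of_iso (hZ.iso h) hCZ

/-- If `0 → X → Y → Z` is exact with `Y` and `Z` in a thick subcategory, so is `X`. -/
theorem IsThick.X₁_mem (hC : IsThick C) {S : ShortComplex (ModuleCat.{u} R)} (hS : S.Exact)
    [Mono S.f] (h₂ : C S.X₂) (h₃ : C S.X₃) : C S.X₁ := by
  have := hC.isClosedUnderKernels
  exact C.prop_of_isLimit_kernelFork hS.fIsKernel h₂ h₃

theorem IsThick.X₃_mem (hC : IsThick C) {S : ShortComplex (ModuleCat.{u} R)} (hS : S.Exact)
    [Epi S.g] (h₁ : C S.X₁) (h₂ : C S.X₂) : C S.X₃ := by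
  have := hC.isClosedUnderCokernels
  exact C.prop_of_isColimit_cokernelCofork hS.gIsCokernel h₁ h₂

theorem IsThick.X₂_mem (hC : IsThick C) {S : ShortComplex (ModuleCat.{u} R)} (hS : S.ShortExact)
    (h₁ : C S.X₁) (h₃ : C S.X₃) : C S.X₂ :=
  hC.isClosedUnderExtensions.prop_X₂_of_shortExact hS h₁ h₃

/-- Closure under summands follows from closure under kernels: `X` is the kernel of the idempotent
endomorphism of `X ⊞ Y` that projects onto `Y`. -/
theorem IsThick.biprod_iff (hC : IsThick C) (X Y : ModuleCat.{u} R) :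
    C (X ⊞ Y) ↔ C X ∧ C Y := by
  have key (X Y : ModuleCat.{u} R) (h : C (X ⊞ Y)) : C X := by
    let S : ShortComplex (ModuleCat.{u} R) :=
      ShortComplex.mk (biprod.inl : X ⟶ X ⊞ Y) (biprod.snd ≫ (biprod.inr : Y ⟶ X ⊞ Y)) (by simp)
    have hS : S.Exact := by
      refine (ShortComplex.exact_iff_of_epi_of_isIso_of_mono
        (S₁ := ShortComplex.mk (biprod.inl : X ⟶ X ⊞ Y) biprod.snd (by simp)) (S₂ := S)
        { τ₁ := 𝟙 _, τ₂ := 𝟙 _, τ₃ := biprod.inr }).1 ?_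
      exact (ShortComplex.Splitting.ofHasBinaryBiproduct X Y).exact
    have : Mono S.f := inferInstanceAs (Mono (biprod.inl : X ⟶ X ⊞ Y))
    exact hC.X₁_mem hS h h
  refine ⟨fun h => ⟨key X Y h, key Y X (hC.of_iso (biprod.braiding X Y) h)⟩, fun h => ?_⟩
  exact hC.X₂_mem (ShortComplex.Splitting.ofHasBinaryBiproduct X Y).shortExact h.1 h.2

theorem isFG_biprod_iff (X Y : ModuleCat.{u} R) :
    ModuleCat.isFG R (X ⊞ Y) ↔ ModuleCat.isFG R X ∧ ModuleCat.isFG R Y :=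
  ⟨fun h => ⟨isFG_of_epi biprod.fst h, isFG_of_epi biprod.snd h⟩, fun h =>
    isFG_of_shortExact (ShortComplex.Splitting.ofHasBinaryBiproduct X Y).shortExact h.1 h.2⟩

theorem leftPerp_biprod_iff (X Y : ModuleCat.{u} R) :
    leftPerp C (X ⊞ Y) ↔ leftPerp C X ∧ leftPerp C Y := by
  simp only [leftPerp_iff, isFG_biprod_iff, extOrthogonal_biprod_left_iff]
  exact ⟨fun h => ⟨⟨h.1.1, fun U hU => (h.2 U hU).1⟩, ⟨h.1.2, fun U hU => (h.2 U hU).2⟩⟩,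
    fun h => ⟨⟨h.1.1, h.2.1⟩, fun U hU => ⟨h.1.2 U hU, h.2.2 U hU⟩⟩⟩

/-- A thick subcategory containing `A` contains all modules with a filtration by `A`. -/
theorem IsThick.filtered_le (hC : IsThick C) {A : ObjectProperty (ModuleCat.{u} R)}
    (h : A ≤ C) : Filtered A ≤ C := by
  intro M hM
  induction hM with
  | zero M hM => exact hC.of_isZero hM
  | step S hS _ h₃ ih => exact hC.X₂_mem hS ih (h _ h₃)

theorem Filtered.of_iso {A : ObjectProperty (ModuleCat.{u} R)} {X Y : ModuleCat.{u} R}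
    (h : Filtered A X) (e : X ≅ Y) : Filtered A Y := by
  cases h with
  | zero _ hX => exact .zero _ (hX.of_iso e.symm)
  | step S hS h₁ h₃ =>
    refine .step (ShortComplex.mk (S.f ≫ e.hom) (e.inv ≫ S.g) (by simp)) ?_ h₁ h₃
    exact ShortComplex.shortExact_of_iso (ShortComplex.isoMk (S₁ := S) (Iso.refl _) e (Iso.refl _)) hS

end Thick

/-! ## Coordinates on the interval modules -/

section UpperTriangular

variable (k : Type u) [Field k] (n : ℕ)

noncomputable instance : Algebra k (UpperTriangular k n) :=
  inferInstanceAs (Algebra k ↥(Matrix.blockTriangularSubalgebra k k (id : Fin n → Fin n)))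

instance : Module.Finite k (UpperTriangular k n) :=
  inferInstanceAs (Module.Finite k
    ↥(Subalgebra.toSubmodule (Matrix.blockTriangularSubalgebra k k (id : Fin n → Fin n))))

instance : IsNoetherianRing (UpperTriangular k n) :=
  isNoetherian_of_tower k inferInstance

instance : IsArtinianRing (UpperTriangular k n) :=
  isArtinian_of_tower k inferInstance

variable {k n}

/-! ### Matrix units and column matrices -/

namespace UpperTriangular

theorem ext_entries {M N : UpperTriangular k n} (h : ∀ i j, M.1 i j = N.1 i j) : M = N :=
  Subtype.ext (Matrix.ext h)

theorem entry_eq_zero (M : UpperTriangular k n) {i j : Fin n} (h : j < i) : M.1 i j = 0 := M.2 h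

theorem mul_entry (M N : UpperTriangular k n) (i j : Fin n) :
    (M * N).1 i j = ∑ t, M.1 i t * N.1 t j := rfl

theorem add_entry (M N : UpperTriangular k n) (i j : Fin n) :
    (M + N).1 i j = M.1 i j + N.1 i j := rfl

theorem one_entry (i j : Fin n) : (1 : UpperTriangular k n).1 i j = if i = j then 1 else 0 := rfl

theorem smul_entry (c : k) (M : UpperTriangular k n) (i j : Fin n) :
    (c • M).1 i j = c * M.1 i j := rfl

theorem sum_entry {ι : Type*} (s : Finset ι) (f : ι → UpperTriangular k n) (i j : Fin n) :
    (∑ t ∈ s, f t).1 i j = ∑ t ∈ s, (f t).1 i j := by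
  classical
  induction s using Finset.induction_on with
  | empty => rfl
  | insert t s ht ih => rw [Finset.sum_insert ht, Finset.sum_insert ht, add_entry, ih]

/-- The matrix whose column `j` is `v`, cut off below the diagonal, all other columns being zero. -/
noncomputable def col (j : Fin n) (v : Fin n → k) : UpperTriangular k n :=
  ⟨fun s t => if t = j ∧ s ≤ j then v s else 0, fun s t h => if_neg (by
    rintro ⟨rfl, h'⟩
    exact h.not_ge h')⟩

theorem col_entry (j : Fin n) (v : Fin n → k) (s t : Fin n) :
    (col j v).1 s t = if t = j ∧ s ≤ j then v s else 0 := rfl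

/-- The matrix unit at `(i, j)` if `i ≤ j`, and zero otherwise. -/
noncomputable def unit (i j : Fin n) : UpperTriangular k n := col j (Pi.single i 1)

theorem unit_entry (i j s t : Fin n) :
    (unit i j : UpperTriangular k n).1 s t = if t = j ∧ s = i ∧ i ≤ j then 1 else 0 := by
  by_cases h : s = i
  · subst h
    simp [unit, col_entry]
  · simp [unit, col_entry, h]

theorem sum_unit_self : (∑ i, unit i i : UpperTriangular k n) = 1 := by
  refine ext_entries fun s t => ?_
  rw [sum_entry, one_entry, Finset.sum_eq_single t]
  · simp [unit_entry]
  · intro x _ hx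
    simp [unit_entry, hx.symm]
  · simp

theorem col_eq_sum (j : Fin n) (v : Fin n → k) : col j v = ∑ t, v t • unit t j := by
  refine ext_entries fun s t => ?_
  rw [sum_entry, Finset.sum_eq_single s]
  · simp [smul_entry, unit_entry, col_entry]
  · intro x _ hx
    simp [smul_entry, unit_entry, hx.symm]
  · simp

/-- The vanishing of `v` below the diagonal ensures that the cut-off in `col j v` discards nothing.
-/
theorem mul_col (M : UpperTriangular k n) {j : Fin n} {v : Fin n → k} (hv : ∀ s, j < s → v s = 0) :
    M * col j v = col j (fun s => ∑ t, M.1 s t * v t) := by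
  refine ext_entries fun s t => ?_
  rw [mul_entry, col_entry]
  by_cases ht : t = j
  · subst ht
    have h : ∀ x, (col t v).1 x t = v x := fun x => by
      rw [col_entry]
      split_ifs with h
      · rfl
      · exact (hv x (by by_contra h'; exact h ⟨rfl, not_lt.1 h'⟩)).symm
    simp only [h, true_and]
    split_ifs with h'
    · rfl
    · refine Finset.sum_eq_zero fun x _ => ?_
      rcases lt_or_ge x s with hx | hx
      · rw [M.entry_eq_zero hx, zero_mul]
      · rw [hv x ((not_le.1 h').trans_le hx), mul_zero]
  · simp [col_entry, ht]

theorem unit_mul {i j : Fin n} (hij : i ≤ j) (M : UpperTriangular k n) :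
    unit i j * M = ∑ s, M.1 j s • unit i s := by
  refine ext_entries fun x y => ?_
  rw [mul_entry, sum_entry, Finset.sum_eq_single j, Finset.sum_eq_single y]
  · simp only [smul_entry, unit_entry, hij]
    by_cases hx : x = i
    · by_cases hy : i ≤ y
      · simp [hx, hy]
      · simp [hx, hy, M.entry_eq_zero ((not_le.1 hy).trans_le hij)]
    · simp [hx]
  · intro s _ hs
    simp [smul_entry, unit_entry, hs.symm]
  · simp
  · intro s _ hs
    simp [unit_entry, hs]
  · simp

end UpperTriangular

end UpperTriangular

section IntervalModule

open UpperTriangular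

variable {k : Type u} [Field k] {n : ℕ} {a b c d : Fin (n + 1)}

/-- The coordinates of an element of the interval module. -/
noncomputable def intervalCoord (x : intervalModule k n a b) (i : Fin n) : k :=
  Quotient.liftOn' x (fun v => if a.val ≤ i.val then v.1 i else 0) (by
    intro v w h
    have h' := (Submodule.quotientRel_def _).1 h
    split_ifs with hi
    · exact sub_eq_zero.1 (h' i hi)
    · rfl)

/-- The element of the interval module with given coordinates. -/
noncomputable def intervalMk (a b : Fin (n + 1)) (v : Fin n → k) : intervalModule k n a b :=
  Submodule.Quotient.mk ⟨fun i => if i.val < b.val then v i else 0, fun _ hi => if_neg hi.not_gt⟩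

theorem intervalCoord_mk (v : initialSubmodule k n b) (i : Fin n) :
    intervalCoord (a := a) (Submodule.Quotient.mk v) i = if a.val ≤ i.val then v.1 i else 0 := rfl

theorem intervalCoord_intervalMk (v : Fin n → k) (i : Fin n) :
    intervalCoord (intervalMk a b v) i = if a.val ≤ i.val ∧ i.val < b.val then v i else 0 := by
  rw [intervalMk, intervalCoord_mk, ite_and]

theorem intervalModule_ind {motive : intervalModule k n a b → Prop}
    (h : ∀ v : initialSubmodule k n b, motive (Submodule.Quotient.mk v)) (x) : motive x :=
  Quotient.inductionOn' x h

theorem intervalCoord_add (x y : intervalModule k n a b) (i : Fin n) :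
    intervalCoord (x + y) i = intervalCoord x i + intervalCoord y i := by
  induction x using intervalModule_ind with
  | h v =>
    induction y using intervalModule_ind with
    | h w =>
      change (if _ then v.1 i + w.1 i else 0) = (if _ then v.1 i else 0) + (if _ then w.1 i else 0)
      split_ifs <;> simp

theorem intervalCoord_zero (i : Fin n) : intervalCoord (0 : intervalModule k n a b) i = 0 := by
  have := intervalCoord_add (0 : intervalModule k n a b) 0 i
  rwa [add_zero, left_eq_add] at this

theorem intervalCoord_smul (M : UpperTriangular k n) (x : intervalModule k n a b) (i : Fin n) :
    intervalCoord (M • x) i = if a.val ≤ i.val then ∑ j, M.1 i j * intervalCoord x j else 0 := by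
  induction x using intervalModule_ind with
  | h v =>
    change (if _ then ∑ j, M.1 i j * v.1 j else 0) = _
    split_ifs with hi
    · refine Finset.sum_congr rfl fun j _ => ?_
      rw [intervalCoord_mk]
      split_ifs with hj
      · rfl
      · rw [M.entry_eq_zero (show j.val < i.val by omega), zero_mul, zero_mul]
    · rfl

theorem intervalCoord_eq_zero (x : intervalModule k n a b) {i : Fin n}
    (h : ¬ (a.val ≤ i.val ∧ i.val < b.val)) : intervalCoord x i = 0 := by
  induction x using intervalModule_ind with
  | h v =>
    rw [intervalCoord_mk]
    split_ifs with hi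
    · exact v.2 i (by omega)
    · rfl

theorem intervalModule_ext {x y : intervalModule k n a b}
    (h : ∀ i : Fin n, a.val ≤ i.val → i.val < b.val → intervalCoord x i = intervalCoord y i) :
    x = y := by
  induction x using intervalModule_ind with
  | h v =>
    induction y using intervalModule_ind with
    | h w =>
      refine (Submodule.Quotient.eq _).2 ?_
      intro i hi
      change v.1 i - w.1 i = 0
      by_cases hb : i.val < b.val
      · have := h i hi hb
        rw [intervalCoord_mk, intervalCoord_mk, if_pos hi, if_pos hi] at this
        rw [this, sub_self]
      · rw [v.2 i (by omega), w.2 i (by omega), sub_self]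

theorem intervalCoord_unit_smul {i j : Fin n} (hij : i ≤ j) (x : intervalModule k n a b)
    (t : Fin n) : intervalCoord ((unit i j : UpperTriangular k n) • x) t =
      if t = i ∧ a.val ≤ i.val then intervalCoord x j else 0 := by
  rw [intervalCoord_smul, Finset.sum_eq_single j]
  · by_cases ht : t = i
    · subst ht
      simp [unit_entry, hij]
    · simp [unit_entry, ht]
  · intro s _ hs
    simp [unit_entry, hs]
  · simp

theorem subsingleton_intervalModule (h : b ≤ a) : Subsingleton (intervalModule k n a b) :=
  ⟨fun _ _ => intervalModule_ext fun i h1 h2 => by omega⟩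

theorem isZero_intervalModule (h : b ≤ a) : IsZero (intervalModule k n a b) := by
  have := subsingleton_intervalModule (k := k) h
  exact ModuleCat.isZero_of_subsingleton _

/-- A linear map into an interval module, given by its coordinates. -/
noncomputable def intervalLift {U : Type*} [AddCommGroup U] [Module (UpperTriangular k n) U]
    (F : U → Fin n → k) (hadd : ∀ u v i, F (u + v) i = F u i + F v i)
    (hsmul : ∀ (M : UpperTriangular k n) u (i : Fin n), a.val ≤ i.val → i.val < b.val →
      F (M • u) i = ∑ j, M.1 i j * (if a.val ≤ j.val ∧ j.val < b.val then F u j else 0)) :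
    U →ₗ[UpperTriangular k n] intervalModule k n a b where
  toFun u := intervalMk a b (F u)
  map_add' u v := intervalModule_ext fun i h1 h2 => by
    simp [intervalCoord_add, intervalCoord_intervalMk, h1, h2, hadd]
  map_smul' M u := intervalModule_ext fun i h1 h2 => by
    simp [intervalCoord_smul, intervalCoord_intervalMk, h1, h2, hsmul]

/-- The canonical map `[a, b] → [c, d]`, for `a ≤ c` and `b ≤ d`. -/
noncomputable def intervalMap (h : a ≤ c) (h' : b ≤ d) :
    intervalModule k n a b →ₗ[UpperTriangular k n] intervalModule k n c d :=
  intervalLift intervalCoord intervalCoord_add fun M u i h1 h2 => by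
    rw [intervalCoord_smul, if_pos (by omega)]
    refine Finset.sum_congr rfl fun j _ => ?_
    split_ifs with hj
    · rfl
    · rcases lt_or_ge j i with hji | hji
      · rw [M.entry_eq_zero hji, zero_mul, zero_mul]
      · rw [intervalCoord_eq_zero u (by omega)]

theorem intervalCoord_intervalMap (h : a ≤ c) (h' : b ≤ d) (x : intervalModule k n a b)
    (i : Fin n) : intervalCoord (intervalMap h h' x) i =
      if c.val ≤ i.val ∧ i.val < d.val then intervalCoord x i else 0 :=
  intervalCoord_intervalMk _ _

/-! ### Interval modules as cyclic modules -/

section Generator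

variable {U : Type*} [AddCommGroup U] [Module (UpperTriangular k n) U] {j : Fin n}

theorem scalar_smul_smul (t : k) (M : UpperTriangular k n) (m : U) :
    (t • M) • m = algebraMap k (UpperTriangular k n) t • M • m := by
  rw [smul_smul, Algebra.smul_def]

theorem col_smul (v : Fin n → k) (m : U) :
    col j v • m = ∑ t, algebraMap k (UpperTriangular k n) (v t) •
      ((unit t j : UpperTriangular k n) • m) := by
  rw [col_eq_sum, Finset.sum_smul]
  exact Finset.sum_congr rfl fun t _ => scalar_smul_smul _ _ _

theorem col_smul_congr {v w : Fin n → k} {m : U}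
    (h : ∀ t, v t = w t ∨ (unit t j : UpperTriangular k n) • m = 0) :
    col j v • m = col j w • m := by
  rw [col_smul, col_smul]
  refine Finset.sum_congr rfl fun t _ => ?_
  rcases h t with h | h
  · rw [h]
  · rw [h, smul_zero, smul_zero]

/-- The linear map from `[a, j + 1]` given by an element which is annihilated by the paths
of length more than `j - a` which start in `j`. -/
noncomputable def intervalDesc (hj : j.val + 1 = b.val) (m : U)
    (hm : ∀ t : Fin n, t.val < a.val → (unit t j : UpperTriangular k n) • m = 0) :
    intervalModule k n a b →ₗ[UpperTriangular k n] U where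
  toFun x := col j (intervalCoord x) • m
  map_add' x y := by
    rw [col_smul, col_smul, col_smul, ← Finset.sum_add_distrib]
    refine Finset.sum_congr rfl fun t _ => ?_
    rw [intervalCoord_add, map_add, add_smul]
  map_smul' M x := by
    rw [RingHom.id_apply, smul_smul, mul_col]
    -- Coordinates below `a` are zero in `[a, b]` but may be nonzero in the matrix product; there
    -- the path from `j` kills `m`.
    · refine col_smul_congr fun t => ?_
      rcases lt_or_ge t.val a.val with h | h
      · exact Or.inr (hm t h)
      · exact Or.inl (by rw [intervalCoord_smul, if_pos h])
    · intro s hs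
      exact intervalCoord_eq_zero x (by omega)

/-- The generator of `[a, j + 1]`. -/
noncomputable def intervalGen (a b : Fin (n + 1)) (j : Fin n) : intervalModule k n a b :=
  intervalMk a b (Pi.single j 1)

theorem intervalCoord_gen (hj : j.val + 1 = b.val) (i : Fin n) :
    intervalCoord (intervalGen (k := k) a b j) i = if i = j ∧ a.val ≤ j.val then 1 else 0 := by
  rw [intervalGen, intervalCoord_intervalMk]
  by_cases h : i = j
  · subst h
    have : i.val < b.val := by omega
    simp [this]
  · simp [h]

theorem col_smul_gen (hj : j.val + 1 = b.val) (x : intervalModule k n a b) :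
    col j (intervalCoord x) • intervalGen a b j = x := by
  refine intervalModule_ext fun i h1 h2 => ?_
  rw [intervalCoord_smul, if_pos h1, Finset.sum_eq_single j]
  · rw [intervalCoord_gen hj, if_pos ⟨rfl, by omega⟩, col_entry, if_pos ⟨rfl, by omega⟩, mul_one]
  · intro s _ hs
    rw [col_entry, if_neg (fun h => hs h.1), zero_mul]
  · simp

theorem unit_smul_gen (hj : j.val + 1 = b.val) :
    (unit j j : UpperTriangular k n) • intervalGen (k := k) a b j = intervalGen a b j := by
  refine intervalModule_ext fun i h1 h2 => ?_
  rw [intervalCoord_unit_smul le_rfl, intervalCoord_gen hj, intervalCoord_gen hj]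
  by_cases h : i = j <;> simp [h]

theorem intervalHom_ext (hj : j.val + 1 = b.val)
    {f g : intervalModule k n a b →ₗ[UpperTriangular k n] U}
    (h : f (intervalGen a b j) = g (intervalGen a b j)) : f = g := by
  ext x
  rw [← col_smul_gen hj x, map_smul, map_smul, h]

theorem isFG_intervalModule : ModuleCat.isFG _ (intervalModule k n a b) := by
  rw [ModuleCat.isFG_iff]
  by_cases hb : b.val = 0
  · have := subsingleton_intervalModule (k := k) (a := a) (b := b) (by omega)
    infer_instance
  · let j : Fin n := ⟨b.val - 1, by omega⟩
    have hj : j.val + 1 = b.val := by simp only [j]; omega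
    refine ⟨⟨{intervalGen a b j}, ?_⟩⟩
    rw [eq_top_iff]
    intro x _
    rw [← col_smul_gen hj x]
    exact Submodule.smul_mem _ _ (Submodule.subset_span (by simp))

end Generator

/-! ### Homomorphisms between interval modules -/

section Hom

variable {j : Fin n} (f : intervalModule k n a b →ₗ[UpperTriangular k n] intervalModule k n c d)

theorem intervalCoord_hom_gen (hj : j.val + 1 = b.val) {t : Fin n} (ht : t ≠ j) :
    intervalCoord (f (intervalGen a b j)) t = 0 := by
  rw [← unit_smul_gen hj, map_smul, intervalCoord_unit_smul le_rfl, if_neg (fun h => ht h.1)]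

theorem intervalHom_ext_coord (hj : j.val + 1 = b.val)
    {f g : intervalModule k n a b →ₗ[UpperTriangular k n] intervalModule k n c d}
    (h : intervalCoord (f (intervalGen a b j)) j = intervalCoord (g (intervalGen a b j)) j) :
    f = g := by
  refine intervalHom_ext hj (intervalModule_ext fun t _ _ => ?_)
  by_cases ht : t = j
  · rw [ht, h]
  · rw [intervalCoord_hom_gen f hj ht, intervalCoord_hom_gen g hj ht]

theorem exists_pred (h : a < b) : ∃ j : Fin n, j.val + 1 = b.val :=
  ⟨⟨b.val - 1, by omega⟩, by simp only; omega⟩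

variable {f}

/-- A homomorphism is determined by coordinate `j = b - 1` of the image of the generator, so `c ≤ j
< d`. If `c < a`, the path from `j` to the vertex with index `c` would kill the generator but not
its image. -/
theorem bounds_of_hom_ne_zero (hf : f ≠ 0) : a ≤ c ∧ c < b ∧ b ≤ d := by
  have hab : a < b := by
    by_contra h
    have := subsingleton_intervalModule (k := k) (not_lt.1 h)
    exact hf (by ext x; rw [Subsingleton.elim x 0]; simp)
  obtain ⟨j, hj⟩ := exists_pred hab
  have hne : intervalCoord (f (intervalGen a b j)) j ≠ 0 := fun h =>
    hf (intervalHom_ext_coord hj (by rw [h, LinearMap.zero_apply, intervalCoord_zero]))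
  have hcd : c.val ≤ j.val ∧ j.val < d.val := by
    by_contra h
    exact hne (intervalCoord_eq_zero _ h)
  refine ⟨?_, by omega, by omega⟩
  by_contra hac
  let s : Fin n := ⟨c.val, by omega⟩
  have hs : s.val = c.val := rfl
  have h0 : (unit s j : UpperTriangular k n) • intervalGen (k := k) a b j = 0 := by
    refine intervalModule_ext fun i h1 h2 => ?_
    rw [intervalCoord_unit_smul (by omega), if_neg (by omega), intervalCoord_zero]
  have h1 := congrArg (fun x => intervalCoord (f x) s) h0
  simp only [map_smul, map_zero, intervalCoord_zero] at h1
  rw [intervalCoord_unit_smul (by omega), if_pos ⟨rfl, by omega⟩] at h1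
  exact hne h1

/-- If `a < c`, the path from `j` to the vertex with index `a` does not kill the generator, but it
kills the image, as `[c, d]` vanishes at that vertex. -/
theorem le_of_hom_injective (hab : a < b) (hf : Function.Injective f) : c ≤ a := by
  obtain ⟨j, hj⟩ := exists_pred hab
  by_contra hca
  let s : Fin n := ⟨a.val, by omega⟩
  have hs : s.val = a.val := rfl
  have h0 : (unit s j : UpperTriangular k n) • intervalGen (k := k) a b j = 0 := by
    apply hf
    refine intervalModule_ext fun i h1 h2 => ?_
    rw [map_smul, map_zero, intervalCoord_unit_smul (by omega), if_neg (by omega),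
      intervalCoord_zero]
  have h1 := congrArg (fun x => intervalCoord x s) h0
  simp only [intervalCoord_zero] at h1
  rw [intervalCoord_unit_smul (by omega), if_pos ⟨rfl, by omega⟩, intervalCoord_gen hj,
    if_pos ⟨rfl, by omega⟩] at h1
  exact one_ne_zero h1

theorem intervalMap_ne_zero (hac : a ≤ c) (hcb : c < b) (hbd : b ≤ d) :
    intervalMap (k := k) hac hbd ≠ 0 := by
  obtain ⟨j, hj⟩ := exists_pred hcb
  intro h
  have h1 := congrArg (fun f => intervalCoord (f (intervalGen a b j)) j) h
  simp only [LinearMap.zero_apply, intervalCoord_zero] at h1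
  rw [intervalCoord_intervalMap, if_pos (by omega), intervalCoord_gen hj,
    if_pos ⟨rfl, by omega⟩] at h1
  exact one_ne_zero h1

/-- A nonzero endomorphism multiplies by the scalar `t ≠ 0` found at the generator, so coordinates
are divided by `t` to get preimages. -/
theorem surjective_of_hom_ne_zero {f : intervalModule k n a b →ₗ[UpperTriangular k n]
    intervalModule k n a b} (hf : f ≠ 0) : Function.Surjective f := by
  obtain ⟨h1, h2, h3⟩ := bounds_of_hom_ne_zero hf
  obtain ⟨j, hj⟩ := exists_pred h2
  have hne : intervalCoord (f (intervalGen a b j)) j ≠ 0 := fun h =>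
    hf (intervalHom_ext_coord hj (by rw [h, LinearMap.zero_apply, intervalCoord_zero]))
  set t := intervalCoord (f (intervalGen a b j)) j with ht
  intro y
  refine ⟨intervalMk a b (fun i => t⁻¹ * intervalCoord y i), intervalModule_ext fun i h1 h2 => ?_⟩
  rw [← col_smul_gen hj (intervalMk a b (fun i => t⁻¹ * intervalCoord y i)), map_smul,
    intervalCoord_smul, if_pos h1, Finset.sum_eq_single j, col_entry, if_pos ⟨rfl, by omega⟩,
    intervalCoord_intervalMk, if_pos ⟨h1, h2⟩, ← ht]
  · field_simp
  · intro s _ hs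
    rw [intervalCoord_hom_gen f hj hs, mul_zero]
  · simp

end Hom

/-! ### Exact sequences and orthogonality of interval modules -/

/-- The complex `[a, c] → [a, b] → [c, d]`. -/
noncomputable def intervalComplex (hac : a ≤ c) (hcb : c ≤ b) (hbd : b ≤ d) :
    ShortComplex (ModuleCat.{u} (UpperTriangular k n)) :=
  ShortComplex.mk (X₁ := intervalModule k n a c) (X₂ := intervalModule k n a b)
    (X₃ := intervalModule k n c d) (ModuleCat.ofHom (intervalMap le_rfl hcb))
    (ModuleCat.ofHom (intervalMap hac hbd)) (by
      ext x
      refine intervalModule_ext fun i h1 h2 => ?_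
      change intervalCoord (intervalMap hac hbd (intervalMap le_rfl hcb x)) i = intervalCoord 0 i
      rw [intervalCoord_intervalMap, if_pos ⟨h1, h2⟩, intervalCoord_intervalMap,
        intervalCoord_eq_zero x (by omega), intervalCoord_zero, ite_self])

/-- The case `b = d` gives the basic short exact sequences; the case `b < d` computes the kernel
that makes partitions of thick subcategories non-crossing. -/
theorem intervalComplex_exact (hac : a ≤ c) (hcb : c ≤ b) (hbd : b ≤ d) :
    (intervalComplex (k := k) hac hcb hbd).Exact := by
  rw [ShortComplex.moduleCat_exact_iff]
  intro (x : intervalModule k n a b) hx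
  refine ⟨intervalMk a c (intervalCoord x), ?_⟩
  refine intervalModule_ext fun i h1 h2 => ?_
  change intervalCoord (intervalMap le_rfl hcb (intervalMk a c (intervalCoord x))) i = _
  rw [intervalCoord_intervalMap, if_pos ⟨h1, h2⟩, intervalCoord_intervalMk]
  split_ifs with h
  · rfl
  · have h0 : intervalCoord (intervalMap hac hbd x) i = intervalCoord 0 i :=
      congrArg (fun y => intervalCoord (a := c) (b := d) y i) hx
    rw [intervalCoord_intervalMap, if_pos (by omega), intervalCoord_zero] at h0
    exact h0.symm

instance mono_intervalComplex_f (hac : a ≤ c) (hcb : c ≤ b) (hbd : b ≤ d) :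
    Mono (intervalComplex (k := k) hac hcb hbd).f := by
  rw [ModuleCat.mono_iff_injective]
  intro (x : intervalModule k n a c) (y : intervalModule k n a c) hxy
  refine intervalModule_ext fun i h1 h2 => ?_
  have h : intervalCoord (intervalMap le_rfl hcb x) i = intervalCoord (intervalMap le_rfl hcb y) i :=
    congrArg (fun z => intervalCoord (a := a) (b := b) z i) hxy
  rwa [intervalCoord_intervalMap, intervalCoord_intervalMap, if_pos (by omega),
    if_pos (by omega)] at h

instance epi_intervalComplex_g (hac : a ≤ c) (hcb : c ≤ b) :
    Epi (intervalComplex (k := k) hac hcb le_rfl).g := by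
  rw [ModuleCat.epi_iff_surjective]
  intro (x : intervalModule k n c b)
  refine ⟨intervalMk a b (intervalCoord x), ?_⟩
  refine intervalModule_ext fun i h1 h2 => ?_
  change intervalCoord (intervalMap hac le_rfl (intervalMk a b (intervalCoord x))) i = _
  rw [intervalCoord_intervalMap, if_pos ⟨h1, h2⟩, intervalCoord_intervalMk, if_pos (by omega)]

theorem intervalComplex_shortExact (hac : a ≤ c) (hcb : c ≤ b) :
    (intervalComplex (k := k) hac hcb le_rfl).ShortExact where
  exact := intervalComplex_exact _ _ _
  mono_f := inferInstance
  epi_g := inferInstance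

instance projective_intervalModule : Projective (intervalModule k n 0 b) := by
  rcases eq_or_ne b 0 with rfl | hb
  · exact (isZero_intervalModule le_rfl).projective
  · obtain ⟨j, hj⟩ := exists_pred (Fin.pos_of_ne_zero hb)
    refine ⟨fun {E X} f e _ => ?_⟩
    obtain ⟨y, hy⟩ := (ModuleCat.epi_iff_surjective e).1 ‹_› (f.hom (intervalGen 0 b j))
    -- For `a = 0` there is no annihilation condition, so any preimage `y` of the image of the
    -- generator defines a lift.
    refine ⟨ModuleCat.ofHom (intervalDesc hj y fun t ht => absurd ht (by simp)), ?_⟩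
    ext x
    change e.hom (col j (intervalCoord x) • y) = f.hom x
    rw [map_smul]
    erw [hy]
    rw [← map_smul, col_smul_gen hj]

theorem hasProjectiveDimensionLT_intervalModule (hab : a ≤ b) :
    HasProjectiveDimensionLT (intervalModule k n a b) 2 := by
  refine (intervalComplex_shortExact (k := k) (Fin.zero_le a) hab).hasProjectiveDimensionLT_X₃ 1
    ?_ ?_
  · exact inferInstanceAs (HasProjectiveDimensionLT (intervalModule k n 0 a) 1)
  · have : HasProjectiveDimensionLT (intervalModule k n 0 b) 1 := inferInstance
    exact hasProjectiveDimensionLT_of_ge (intervalModule k n 0 b) 1 2 (by simp)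

theorem subsingleton_intervalHom (h : ¬ (a ≤ c ∧ c < b ∧ b ≤ d)) :
    Subsingleton (intervalModule k n a b ⟶ intervalModule k n c d) := by
  refine subsingleton_of_forall_eq 0 fun f => ?_
  by_contra hf
  exact h (bounds_of_hom_ne_zero (f := f.hom) fun h0 => hf (ModuleCat.hom_ext h0))

/-- The inclusion sends the generator of `[0, a]` to the path from `j = b - 1` to `i = a - 1`
applied to the generator of `[0, b]`. Homomorphisms on either side are thus described by one scalar,
and restriction preserves it. -/
theorem bijective_precomp_intervalMap (hca : c < a) (hab : a ≤ b) (hbd : b ≤ d) :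
    Function.Bijective fun φ : intervalModule k n 0 b ⟶ intervalModule k n c d =>
      ModuleCat.ofHom (intervalMap (k := k) (a := 0) le_rfl hab) ≫ φ := by
  obtain ⟨i, hi⟩ := exists_pred hca
  obtain ⟨j, hj⟩ := exists_pred (hca.trans_le hab)
  have hij : i ≤ j := by omega
  have hgen : intervalMap (k := k) (a := 0) le_rfl hab (intervalGen 0 a i) =
      (unit i j : UpperTriangular k n) • intervalGen 0 b j := by
    refine intervalModule_ext fun t h1 h2 => ?_
    rw [intervalCoord_intervalMap, if_pos ⟨h1, h2⟩, intervalCoord_gen hi,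
      intervalCoord_unit_smul hij, intervalCoord_gen hj]
    simp
  have hval (φ : intervalModule k n 0 b ⟶ intervalModule k n c d) :
      intervalCoord (φ.hom (intervalMap (k := k) (a := 0) le_rfl hab (intervalGen 0 a i))) i =
        intervalCoord (φ.hom (intervalGen 0 b j)) j := by
    rw [hgen, map_smul, intervalCoord_unit_smul hij, if_pos ⟨rfl, by omega⟩]
  constructor
  · intro φ ψ h
    have h' : intervalCoord (φ.hom (intervalMap le_rfl hab (intervalGen 0 a i))) i =
        intervalCoord (ψ.hom (intervalMap le_rfl hab (intervalGen 0 a i))) i :=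
      congrArg (fun f => intervalCoord (f.hom (intervalGen 0 a i)) i) h
    rw [hval, hval] at h'
    exact ModuleCat.hom_ext (intervalHom_ext_coord hj h')
  · intro ψ
    let y : intervalModule k n c d :=
      intervalMk c d (Pi.single j (intervalCoord (ψ.hom (intervalGen 0 a i)) i))
    let φ : intervalModule k n 0 b ⟶ intervalModule k n c d :=
      ModuleCat.ofHom (intervalDesc hj y fun t ht => absurd ht (by simp))
    refine ⟨φ, ModuleCat.hom_ext (intervalHom_ext_coord hi ?_)⟩
    refine (hval φ).trans ?_
    change intervalCoord (col j (intervalCoord (intervalGen (k := k) 0 b j)) • y) j = _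
    rw [intervalCoord_smul, if_pos (by omega), Finset.sum_eq_single j, col_entry,
      if_pos ⟨rfl, le_rfl⟩, intervalCoord_gen hj, if_pos ⟨rfl, by simp⟩, one_mul,
      intervalCoord_intervalMk, if_pos (by omega), Pi.single_eq_same]
    · intro s _ hs
      rw [col_entry, if_neg (fun h => hs h.1), zero_mul]
    · simp

theorem nontrivial_projectiveHom (hcb : c < b) (hbd : b ≤ d) :
    ¬ Subsingleton (intervalModule k n 0 b ⟶ intervalModule k n c d) := by
  intro h
  refine intervalMap_ne_zero (k := k) (Fin.zero_le c) hcb hbd ?_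
  exact congrArg ModuleCat.Hom.hom
    (Subsingleton.elim (ModuleCat.ofHom (intervalMap (k := k) (Fin.zero_le c) hbd)) 0)

/-- `Hom([0, x], [c, d])` is nonzero exactly when `c < x ≤ d`. The restriction map is bijective if
its two sides are both zero or both nonzero, and cannot be otherwise. -/
theorem extOrthogonal_intervalModule_iff (hab : a ≤ b) :
    ExtOrthogonal.{u} (intervalModule k n a b) (intervalModule k n c d) ↔
      ((c < a ∧ a ≤ d) ↔ (c < b ∧ b ≤ d)) := by
  have hS := intervalComplex_shortExact (k := k) (Fin.zero_le a) hab
  have : Projective (intervalComplex (k := k) (Fin.zero_le a) hab le_rfl).X₂ :=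
    inferInstanceAs (Projective (intervalModule k n 0 b))
  refine (extOrthogonal_X₃_iff_of_projective hS _).trans ?_
  change (Function.Bijective fun φ : intervalModule k n 0 b ⟶ intervalModule k n c d =>
      ModuleCat.ofHom (intervalMap (k := k) (a := 0) le_rfl hab) ≫ φ) ↔ _
  by_cases ha : c < a ∧ a ≤ d
  · by_cases hb : c < b ∧ b ≤ d
    · exact iff_of_true (bijective_precomp_intervalMap ha.1 hab hb.2) (by simp [ha, hb])
    · have := subsingleton_intervalHom (k := k) (a := 0) (b := b) (c := c) (d := d)
        (fun h => hb h.2)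
      refine iff_of_false (fun h => ?_) (by simp [ha, hb])
      exact nontrivial_projectiveHom ha.1 ha.2 h.2.subsingleton
  · have := subsingleton_intervalHom (k := k) (a := 0) (b := a) (c := c) (d := d)
      (fun h => ha h.2)
    by_cases hb : c < b ∧ b ≤ d
    · refine iff_of_false (fun h => ?_) (by simp [ha, hb])
      exact nontrivial_projectiveHom hb.1 hb.2 h.1.subsingleton
    · have := subsingleton_intervalHom (k := k) (a := 0) (b := b) (c := c) (d := d)
        (fun h => hb h.2)
      exact iff_of_true ⟨Function.injective_of_subsingleton _, fun x => ⟨0, Subsingleton.elim _ _⟩⟩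
        (by simp [ha, hb])

theorem extOrthogonal_intervalModule_iff_eulerOrthogonal (hab : a ≤ b) (hcd : c ≤ d) :
    ExtOrthogonal.{u} (intervalModule k n a b) (intervalModule k n c d) ↔
      EulerOrthogonal a b c d := by
  rw [extOrthogonal_intervalModule_iff hab, eulerOrthogonal_iff_right hcd]

/-- By the projective resolution, `Ext¹([a, b], [c, d])` is a quotient of `Hom([0, a], [c, d])`,
which vanishes unless `c < a`. -/
theorem lt_of_nontrivial_ext (hab : a ≤ b)
    (h : Nontrivial (Abelian.Ext.{u} (intervalModule k n a b) (intervalModule k n c d) 1)) :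
    c < a := by
  by_contra hca
  refine not_subsingleton_iff_nontrivial.2 h (subsingleton_of_forall_eq 0 fun x => ?_)
  have hS := intervalComplex_shortExact (k := k) (Fin.zero_le a) hab
  have : Projective (intervalComplex (k := k) (Fin.zero_le a) hab le_rfl).X₂ :=
    inferInstanceAs (Projective (intervalModule k n 0 b))
  have : Subsingleton (Abelian.Ext.{u} (intervalComplex (k := k) (Fin.zero_le a) hab le_rfl).X₁
      (intervalModule k n c d) 0) :=
    (subsingleton_ext_zero_iff _ _).2 (subsingleton_intervalHom (by omega))
  obtain ⟨y, rfl⟩ := Abelian.Ext.contravariant_sequence_exact₃ hS _ x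
    (Abelian.Ext.eq_zero_of_projective _) (n₀ := 0) rfl
  rw [Subsingleton.elim y 0]
  exact Abelian.Ext.comp_zero _ _ _ _ _

theorem intervalModule_iso_eq (hab : a < b) (hcd : c < d)
    (e : intervalModule k n a b ≅ intervalModule k n c d) : a = c ∧ b = d := by
  have key {a b c d : Fin (n + 1)} (hab : a < b)
      (e : intervalModule k n a b ≅ intervalModule k n c d) : a ≤ c ∧ b ≤ d ∧ c ≤ a := by
    have hinj := (ModuleCat.mono_iff_injective e.hom).1 inferInstance
    have hne : e.hom.hom ≠ 0 := fun h0 => by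
      obtain ⟨j, hj⟩ := exists_pred hab
      have h1 : intervalGen (k := k) a b j = 0 := hinj
        ((LinearMap.congr_fun h0 _).trans (LinearMap.map_zero e.hom.hom).symm)
      have h2 := congrArg (fun x => intervalCoord x j) h1
      simp only [intervalCoord_zero] at h2
      rw [intervalCoord_gen hj, if_pos ⟨rfl, by omega⟩] at h2
      exact one_ne_zero h2
    obtain ⟨h1, -, h3⟩ := bounds_of_hom_ne_zero hne
    exact ⟨h1, h3, le_of_hom_injective hab hinj⟩
  have h1 := key hab e
  have h2 := key hcd e.symm
  exact ⟨le_antisymm h1.1 h1.2.2, le_antisymm h1.2.1 h2.2.1⟩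

end IntervalModule

/-! ## Decomposition into interval modules -/

section Decomposition

open UpperTriangular

variable {k : Type u} [Field k] {n : ℕ}

theorem exists_maximal_unit_smul_ne_zero (M : Type*) [AddCommGroup M]
    [Module (UpperTriangular k n) M] [Nontrivial M] :
    ∃ (i j : Fin n) (m : M), i ≤ j ∧ (unit i j : UpperTriangular k n) • m ≠ 0 ∧
      ∀ (s t : Fin n) (m' : M), j.val - i.val < t.val - s.val →
        (unit s t : UpperTriangular k n) • m' = 0 := by
  classical
  let T : Finset (Fin n × Fin n) := Finset.univ.filter fun p =>
    p.1 ≤ p.2 ∧ ∃ m : M, (unit p.1 p.2 : UpperTriangular k n) • m ≠ 0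
  have hT : T.Nonempty := by
    obtain ⟨m, hm⟩ := exists_ne (0 : M)
    by_contra hT
    refine hm ?_
    rw [← one_smul (UpperTriangular k n) m, ← sum_unit_self, Finset.sum_smul]
    refine Finset.sum_eq_zero fun i _ => ?_
    by_contra hi
    exact hT ⟨(i, i), Finset.mem_filter.2 ⟨Finset.mem_univ _, le_rfl, m, hi⟩⟩
  obtain ⟨⟨i, j⟩, hp, hmax⟩ := T.exists_max_image (fun p => p.2.val - p.1.val) hT
  obtain ⟨-, hij, m, hm⟩ := Finset.mem_filter.1 hp
  refine ⟨i, j, m, hij, hm, fun s t m' hst => ?_⟩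
  by_contra h
  have := hmax (s, t) (Finset.mem_filter.2 ⟨Finset.mem_univ _, by simp only; omega, m', h⟩)
  simp only at this
  omega

/-- Every nonzero module has an interval module as a retract. -/
theorem exists_retraction (M : Type u) [AddCommGroup M] [Module (UpperTriangular k n) M]
    [Nontrivial M] : ∃ (a b : Fin (n + 1)) (_ : a < b)
      (s : intervalModule k n a b →ₗ[UpperTriangular k n] M)
      (r : M →ₗ[UpperTriangular k n] intervalModule k n a b), r ∘ₗ s = LinearMap.id := by
  obtain ⟨i, j, m, hij, hm, hmax⟩ := exists_maximal_unit_smul_ne_zero (k := k) (n := n) M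
  let a : Fin (n + 1) := ⟨i.val, by omega⟩
  let b : Fin (n + 1) := ⟨j.val + 1, by omega⟩
  have ha : a.val = i.val := rfl
  have hb : b.val = j.val + 1 := rfl
  let : Module k M := Module.compHom M (algebraMap k (UpperTriangular k n))
  have hk (c : k) (x : M) : c • x = algebraMap k (UpperTriangular k n) c • x := rfl
  have hscalar (c : k) (L : UpperTriangular k n) (x : M) : (c • L) • x = c • (L • x) := by
    rw [scalar_smul_smul, hk]
  -- This functional on the underlying vector space splits off the image of `m` under the longest
  -- path.
  obtain ⟨φ, hφ⟩ : ∃ φ : M →ₗ[k] k, φ ((unit i j : UpperTriangular k n) • m) = 1 :=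
    Module.Projective.exists_dual_eq_one k hm
  have hu (s : Fin n) (L : UpperTriangular k n) (x : M) (his : i ≤ s) :
      φ ((unit i s : UpperTriangular k n) • L • x) =
        ∑ t, L.1 s t * φ ((unit i t : UpperTriangular k n) • x) := by
    rw [smul_smul, unit_mul his, Finset.sum_smul, map_sum]
    refine Finset.sum_congr rfl fun t _ => ?_
    rw [hscalar, map_smul, smul_eq_mul]
  -- Coordinate `t` transports `x` to vertex `i` and applies `φ`. Linearity needs the coordinates
  -- with `t > j` to vanish, which is the maximality of the path.
  let r : M →ₗ[UpperTriangular k n] intervalModule k n a b :=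
    intervalLift (fun x t => φ ((unit i t : UpperTriangular k n) • x))
      (fun x y t => by rw [smul_add, map_add]) (fun L x s h1 h2 => by
        rw [hu s L x (by omega)]
        refine Finset.sum_congr rfl fun t _ => ?_
        split_ifs with ht
        · rfl
        · rcases lt_or_ge t.val i.val with h | h
          · rw [L.entry_eq_zero (show t < s by omega), zero_mul, zero_mul]
          · rw [hmax i t x (by omega), map_zero])
  let s : intervalModule k n a b →ₗ[UpperTriangular k n] M :=
    intervalDesc hb.symm m fun t ht => hmax t j m (by omega)
  refine ⟨a, b, by omega, s, r, intervalHom_ext_coord hb.symm ?_⟩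
  change intervalCoord (intervalMk a b fun t => φ ((unit i t : UpperTriangular k n) •
    col j (intervalCoord (intervalGen (k := k) a b j)) • m)) j = _
  rw [intervalCoord_intervalMk, if_pos (by omega), hu j _ _ hij, LinearMap.id_apply,
    intervalCoord_gen hb.symm, if_pos ⟨rfl, by omega⟩, Finset.sum_eq_single j, col_entry,
    if_pos ⟨rfl, le_rfl⟩, intervalCoord_gen hb.symm, if_pos ⟨rfl, by omega⟩, one_mul, hφ]
  · intro t _ ht
    rw [col_entry, if_neg (fun h => ht h.1), zero_mul]
  · simp

theorem exists_iso_biprod (M : ModuleCat.{u} (UpperTriangular k n)) [Nontrivial M] :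
    ∃ (a b : Fin (n + 1)) (_ : a < b) (M' : ModuleCat.{u} (UpperTriangular k n)),
      Nonempty (M ≅ intervalModule k n a b ⊞ M') := by
  obtain ⟨a, b, hab, s, r, hrs⟩ := exists_retraction (k := k) (n := n) M
  let s' : intervalModule k n a b ⟶ M := ModuleCat.ofHom s
  let r' : M ⟶ intervalModule k n a b := ModuleCat.ofHom r
  have h : s' ≫ r' = 𝟙 _ := ModuleCat.hom_ext hrs
  have : Mono s' := by
    have : Mono (s' ≫ r') := by
      rw [h]
      infer_instance
    exact mono_of_mono s' r'
  let S : ShortComplex (ModuleCat.{u} (UpperTriangular k n)) :=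
    ShortComplex.mk s' (cokernel.π s') (cokernel.condition s')
  have hS : S.Exact := ShortComplex.exact_cokernel s'
  have : Epi S.g := inferInstanceAs (Epi (cokernel.π s'))
  exact ⟨a, b, hab, cokernel s',
    ⟨(ShortComplex.Splitting.ofExactOfRetraction S hS r' h this).isoBinaryBiproduct⟩⟩

/-- Every finitely generated module is a finite direct sum of interval modules. -/
theorem interval_induction {C : ObjectProperty (ModuleCat.{u} (UpperTriangular k n))}
    (of_iso : ∀ X Y, (X ≅ Y) → C X → C Y) (zero : ∀ X, IsZero X → C X)
    (biprod_mem : ∀ (a b : Fin (n + 1)) M, a < b → C M → C (intervalModule k n a b ⊞ M))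
    (M : ModuleCat.{u} (UpperTriangular k n)) (hM : ModuleCat.isFG _ M) : C M := by
  induction h : Module.length (UpperTriangular k n) M using WellFoundedLT.induction
    generalizing M with
  | ind l ih =>
    rcases subsingleton_or_nontrivial M with hM' | hM'
    · exact zero M (ModuleCat.isZero_of_subsingleton M)
    obtain ⟨a, b, hab, M', ⟨e⟩⟩ := exists_iso_biprod M
    refine of_iso _ _ e.symm (biprod_mem a b M' hab ?_)
    have hsum := (isFG_biprod_iff _ _).1 (isFG_of_iso e hM)
    refine ih _ ?_ M' hsum.2 rfl
    have hS := (ShortComplex.Splitting.ofHasBinaryBiproduct (intervalModule k n a b) M').shortExact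
    have hadd := Module.length_eq_add_of_exact (R := UpperTriangular k n)
      (biprod.inl : intervalModule k n a b ⟶ _ ⊞ M').hom
      (biprod.snd : intervalModule k n a b ⊞ M' ⟶ _).hom
      ((ModuleCat.mono_iff_injective _).1 hS.mono_f) ((ModuleCat.epi_iff_surjective _).1 hS.epi_g)
      ((ShortComplex.ShortExact.moduleCat_exact_iff_function_exact _).1 hS.exact)
    rw [← h, e.toLinearEquiv.length_eq, hadd]
    have hfin : Module.length (UpperTriangular k n) M' ≠ ⊤ := by
      have := (ModuleCat.isFG_iff M').1 hsum.2
      exact Module.length_ne_top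
    have hpos : 0 < Module.length (UpperTriangular k n) (intervalModule k n a b) := by
      rw [Module.length_pos_iff]
      by_contra hne
      rw [not_nontrivial_iff_subsingleton] at hne
      refine intervalMap_ne_zero (k := k) (le_refl a) hab (le_refl b) ?_
      ext x
      exact Subsingleton.elim _ _
    exact ENat.lt_add_left hfin hpos

end Decomposition

/-! ## Simple objects of thick subcategories -/

section SimpleObjects

variable {R : Type u} [Ring R] {C : ObjectProperty (ModuleCat.{u} R)}

/-- Closure under kernels makes the inclusion into all modules preserve monomorphisms. -/
theorem IsThick.mono_hom (hC : IsThick C) {X Y : C.FullSubcategory} (f : X ⟶ Y) [Mono f] :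
    Mono f.hom := by
  have := hC.isClosedUnderKernels
  have := hC.containsZero
  have := C.preservesMonomorphisms_ι_of_isNormalEpiCategory
  exact C.ι.map_mono f

theorem IsSimpleIn.not_isZero {X : ModuleCat.{u} R} (h : IsSimpleIn C X) : ¬ IsZero X := by
  obtain ⟨hX, hs⟩ := h
  intro h0
  exact id_nonzero (⟨X, hX⟩ : C.FullSubcategory) (ObjectProperty.hom_ext _ (h0.eq_of_src _ _))

/-- A nonzero subobject of a simple object is everything. -/
theorem IsSimpleIn.isIso_of_mono {X : ModuleCat.{u} R} (h : IsSimpleIn C X)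
    {Y : ModuleCat.{u} R} (hY : C Y) (f : Y ⟶ X) [Mono f] (hf : f ≠ 0) : IsIso f := by
  obtain ⟨hX, hs⟩ := h
  let f' : (⟨Y, hY⟩ : C.FullSubcategory) ⟶ ⟨X, hX⟩ := ObjectProperty.homMk f
  have : Mono f' := by
    have : Mono (C.ι.map f') := ‹Mono f›
    exact C.ι.mono_of_mono_map this
  have : IsIso f' := isIso_of_mono_of_nonzero fun h0 => hf (congrArg (fun g => g.hom) h0)
  exact (ObjectProperty.isIso_hom_iff f').2 this

theorem IsThick.isSimpleIn (hC : IsThick C) {X : ModuleCat.{u} R} (hX : C X) (h0 : ¬ IsZero X)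
    (h : ∀ Y (f : Y ⟶ X), C Y → Mono f → f ≠ 0 → Epi f) : IsSimpleIn C X := by
  refine ⟨hX, ⟨fun {Y} f _ => ⟨fun hf h' => ?_, fun hf => ?_⟩⟩⟩
  · subst h'
    have : IsIso (0 : Y.obj ⟶ X) := inferInstanceAs (IsIso (C.ι.map (0 : Y ⟶ ⟨X, hX⟩)))
    exact h0 ((IsZero.iff_id_eq_zero X).2 ((isIsoZeroEquiv Y.obj X) this).2)
  · have := hC.mono_hom f
    have : Epi f.hom := h Y.obj f.hom Y.property this fun h' => hf (ObjectProperty.hom_ext _ h')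
    rw [← ObjectProperty.isIso_hom_iff]
    exact isIso_of_mono_of_epi f.hom

end SimpleObjects

/-! ### Thick subcategories and non-crossing partitions -/

section ThickSubcategories

variable {k : Type u} [Field k] {n : ℕ} {C D : ObjectProperty (ModuleCat.{u} (UpperTriangular k n))}

/-- The hypotheses are weaker than thickness so that the lemma applies to left perpendicular
categories, whose thickness is not known beforehand. -/
theorem le_of_intervalModules (hC : C ≤ ModuleCat.isFG _)
    (isoC : ∀ X Y, (X ≅ Y) → C X → C Y) (biprodC : ∀ X Y, C (X ⊞ Y) → C X ∧ C Y)
    (isoD : ∀ X Y, (X ≅ Y) → D X → D Y) (zeroD : ∀ X, IsZero X → D X)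
    (biprodD : ∀ X Y, D X → D Y → D (X ⊞ Y))
    (h : ∀ a b : Fin (n + 1), a < b → C (intervalModule k n a b) → D (intervalModule k n a b)) :
    C ≤ D := by
  intro M hM
  refine interval_induction (C := fun X => C X → D X) (fun X Y e hX hY => ?_)
    (fun X hX _ => zeroD X hX) (fun a b M' hab hM' hM => ?_) M (hC _ hM) hM
  · exact isoD _ _ e (hX (isoC _ _ e.symm hY))
  · have := biprodC _ _ hM
    exact biprodD _ _ (h a b hab this.1) (hM' this.2)

/-- If two of `[x, y]`, `[y, z]`, `[x, z]` are in a thick subcategory, so is the third. -/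
theorem IsThick.two_of_three (hC : IsThick C) {x y z : Fin (n + 1)} (hxy : x ≤ y) (hyz : y ≤ z) :
    (C (intervalModule k n x y) → C (intervalModule k n y z) → C (intervalModule k n x z)) ∧
    (C (intervalModule k n x y) → C (intervalModule k n x z) → C (intervalModule k n y z)) ∧
    (C (intervalModule k n y z) → C (intervalModule k n x z) → C (intervalModule k n x y)) := by
  have hS := intervalComplex_shortExact (k := k) hxy hyz
  have := hS.mono_f
  have := hS.epi_g
  exact ⟨fun h1 h3 => hC.X₂_mem hS h1 h3, fun h1 h2 => hC.X₃_mem hS.exact h1 h2,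
    fun h3 h2 => hC.X₁_mem hS.exact h2 h3⟩

/-- The partition given by a thick subcategory: `i ~ j` if the interval module between
`i` and `j` belongs to it. -/
def IsThick.partition (hC : IsThick C) : Setoid (Fin (n + 1)) where
  r i j := C (intervalModule k n (min i j) (max i j))
  iseqv :=
    { refl := fun i => hC.of_isZero (isZero_intervalModule (by simp))
      symm := fun {i j} h => by rwa [min_comm, max_comm]
      trans := fun {x y z} h h' => by
        rcases le_total x y with hxy | hxy <;> rcases le_total y z with hyz | hyz <;>
          rcases le_total x z with hxz | hxz <;>
          simp only [hxy, hyz, hxz, min_eq_left, min_eq_right, max_eq_left, max_eq_right]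
            at h h' ⊢
        · exact (hC.two_of_three hxy hyz).1 h h'
        · exact hC.of_isZero (isZero_intervalModule (hxy.trans hyz))
        · exact (hC.two_of_three hxz hyz).2.2 h' h
        · exact (hC.two_of_three hxz hxy).2.2 h h'
        · exact (hC.two_of_three hxy hxz).2.1 h h'
        · exact (hC.two_of_three hyz hxz).2.1 h' h
        · exact hC.of_isZero (isZero_intervalModule (hyz.trans hxy))
        · exact (hC.two_of_three hyz hxy).1 h' h }

theorem IsThick.partition_iff (hC : IsThick C) {a b : Fin (n + 1)} (hab : a ≤ b) :
    hC.partition a b ↔ C (intervalModule k n a b) := by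
  change C (intervalModule k n (min a b) (max a b)) ↔ _
  rw [min_eq_left hab, max_eq_right hab]

/-- For `a < c < b < d` the canonical map `[a, b] → [c, d]` has kernel `[a, c]`. -/
theorem IsThick.isNoncrossing_partition (hC : IsThick C) : IsNoncrossing hC.partition := by
  intro a c b d hac hcb hbd hab hcd
  rw [hC.partition_iff (by omega)] at hab hcd ⊢
  exact hC.X₁_mem (intervalComplex_exact (k := k) hac.le hcb.le hbd.le) hab hcd

/-- Interval modules are filtered by arcs, also in the presence of another direct summand. -/
theorem filtered_biprod {P : Setoid (Fin (n + 1))} {M : ModuleCat.{u} (UpperTriangular k n)}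
    (hM : Filtered (intervalModules k (IsArc P)) M) (l : ℕ) : ∀ a b : Fin (n + 1), a ≤ b →
      b.val = a.val + l → P a b →
      Filtered (intervalModules k (IsArc P)) (intervalModule k n a b ⊞ M) := by
  induction l using Nat.strong_induction_on with
  | _ l ih =>
    intro a b hab hl h
    rcases hab.eq_or_lt with rfl | hlt
    · have hS := (ShortComplex.Splitting.ofHasBinaryBiproduct (intervalModule k n a a) M).shortExact
      have : IsIso (biprod.snd : intervalModule k n a a ⊞ M ⟶ M) :=
        (hS.isIso_g_iff).2 (isZero_intervalModule le_rfl)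
      exact hM.of_iso (asIso (biprod.snd : intervalModule k n a a ⊞ M ⟶ M)).symm
    · obtain ⟨x, hax, harc, hx⟩ := exists_isArc hlt h
      have hxb := harc.1
      let T := intervalComplex (k := k) hax hxb.le (le_refl b)
      have hT : T.ShortExact := intervalComplex_shortExact hax hxb.le
      have := hT.mono_f
      have := hT.epi_g
      -- The last arc `[x, b]` is split off on top, leaving `[a, x] ⊞ M`. Carrying `M` along avoids
      -- proving that filtered modules are closed under direct sums.
      let S : ShortComplex (ModuleCat.{u} (UpperTriangular k n)) :=
        ShortComplex.mk (biprod.map T.f (𝟙 M)) (biprod.fst ≫ T.g) (by simp)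
      have : Mono S.f := inferInstanceAs (Mono (biprod.map T.f (𝟙 M)))
      have : Epi S.g := inferInstanceAs (Epi (biprod.fst ≫ T.g))
      have hS : S.Exact := ShortComplex.exact_of_f_is_kernel _
        (KernelFork.IsLimit.ofι' _ _ fun {A} φ hφ =>
          ⟨biprod.lift (hT.exact.lift (φ ≫ biprod.fst) (by simpa [S] using hφ))
            (φ ≫ biprod.snd), by
            apply biprod.hom_ext
            · simp [S]
            · simp [S]⟩)
      exact .step S { exact := hS } (ih (x.val - a.val) (by omega) a x hax (by omega) hx)
        ⟨x, b, harc, ⟨Iso.refl _⟩⟩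

theorem filtered_intervalModule {P : Setoid (Fin (n + 1))} {a b : Fin (n + 1)} (hab : a ≤ b)
    (h : P a b) : Filtered (intervalModules k (IsArc P)) (intervalModule k n a b) := by
  let Z : ModuleCat.{u} (UpperTriangular k n) := ModuleCat.of _ PUnit
  have hZ : IsZero Z := ModuleCat.isZero_of_subsingleton Z
  have hS := (ShortComplex.Splitting.ofHasBinaryBiproduct (intervalModule k n a b) Z).shortExact
  have : IsIso (biprod.inl : _ ⟶ intervalModule k n a b ⊞ Z) := (hS.isIso_f_iff).2 hZ
  exact (filtered_biprod (.zero _ hZ) (b.val - a.val) a b hab (by omega) h).of_iso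
    (asIso (biprod.inl : _ ⟶ intervalModule k n a b ⊞ Z)).symm

theorem IsThick.eq_filtered (hC : IsThick C) {P : Setoid (Fin (n + 1))}
    (hP : ∀ a b, a ≤ b → (P a b ↔ C (intervalModule k n a b))) :
    C = Filtered (intervalModules k (IsArc P)) := by
  apply le_antisymm
  · intro M hM
    refine interval_induction
      (C := fun X => C X → Filtered (intervalModules k (IsArc P)) X) (fun X Y e hX hY => ?_)
      (fun X hX _ => .zero X hX) (fun a b M' hab hM' hM => ?_) M (hC.le_isFG _ hM) hM
    · exact (hX (hC.of_iso e.symm hY)).of_iso e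
    · have := (hC.biprod_iff _ _).1 hM
      exact filtered_biprod (hM' this.2) (b.val - a.val) a b hab.le (by omega)
        ((hP a b hab.le).2 this.1)
  · refine hC.filtered_le ?_
    rintro X ⟨a, b, harc, ⟨e⟩⟩
    exact hC.of_iso e.symm ((hP a b harc.1.le).1 harc.2.1)

/-! ### Perpendicular categories -/

section Perpendicular

variable (P : Setoid (Fin (n + 1)))

theorem hasProjectiveDimensionLT_of_filtered {M : ModuleCat.{u} (UpperTriangular k n)}
    (hM : Filtered (intervalModules k (IsArc P)) M) : HasProjectiveDimensionLT M 2 := by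
  induction hM with
  | zero M hM =>
    have := hM.hasProjectiveDimensionLT_zero
    exact hasProjectiveDimensionLT_of_ge M 0 2 (by simp)
  | step S hS _ h₃ ih =>
    obtain ⟨a, b, harc, ⟨e⟩⟩ := h₃
    have := hasProjectiveDimensionLT_intervalModule (k := k) harc.1.le
    exact hS.hasProjectiveDimensionLT_X₂ 2 ih (hasProjectiveDimensionLT_of_iso e.symm 2)

variable {P}

theorem extOrthogonal_of_filtered_left {M U : ModuleCat.{u} (UpperTriangular k n)}
    (hM : Filtered (intervalModules k (IsArc P)) M)
    (h : ∀ a b, a ≤ b → P a b → ExtOrthogonal.{u} (intervalModule k n a b) U) :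
    ExtOrthogonal.{u} M U := by
  induction hM with
  | zero M hM => exact extOrthogonal_of_isZero_left hM U
  | step S hS _ h₃ ih =>
    obtain ⟨a, b, harc, ⟨e⟩⟩ := h₃
    have h1 := (extOrthogonal_iff _ _).1 ih
    have h3 := (extOrthogonal_iff _ _).1 ((h a b harc.1.le harc.2.1).of_iso_left e.symm)
    have := h1.1
    have := h1.2
    have := h3.1
    have := h3.2
    exact (extOrthogonal_iff _ _).2
      ⟨subsingleton_ext_X₂_left hS U 0, subsingleton_ext_X₂_left hS U 1⟩

theorem extOrthogonal_of_filtered_right {M V : ModuleCat.{u} (UpperTriangular k n)}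
    (hM : Filtered (intervalModules k (IsArc P)) M)
    (h : ∀ c d, c ≤ d → P c d → ExtOrthogonal.{u} V (intervalModule k n c d)) :
    ExtOrthogonal.{u} V M := by
  induction hM with
  | zero M hM => exact extOrthogonal_of_isZero_right hM V
  | step S hS _ h₃ ih =>
    obtain ⟨a, b, harc, ⟨e⟩⟩ := h₃
    have h1 := (extOrthogonal_iff _ _).1 ih
    have h3 := (extOrthogonal_iff _ _).1 ((h a b harc.1.le harc.2.1).of_iso_right e.symm)
    have := h1.1
    have := h1.2
    have := h3.1
    have := h3.2
    exact (extOrthogonal_iff _ _).2 ⟨subsingleton_ext_X₂ hS V 0, subsingleton_ext_X₂ hS V 1⟩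

theorem EulerOrthogonal.swap_left {m : ℕ} {a b c d : Fin m} (h : EulerOrthogonal a b c d) :
    EulerOrthogonal b a c d := by
  simp only [EulerOrthogonal] at h ⊢
  omega

/-- Orthogonality to the arcs passes along filtrations, and conversely `[a, b]` is filtered by arcs
for every related pair `a ≤ b`. -/
theorem rightPerp_intervalModule_iff {c d : Fin (n + 1)} (hcd : c ≤ d) :
    rightPerp (Filtered (intervalModules k (IsArc P))) (intervalModule k n c d) ↔
      rightDual P c d := by
  rw [rightPerp_iff, rightDual_apply]
  constructor
  · intro h a b hab
    rcases le_total a b with hle | hle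
    · exact (extOrthogonal_intervalModule_iff_eulerOrthogonal hle hcd).1
        (h.2 _ (filtered_intervalModule hle hab))
    · exact ((extOrthogonal_intervalModule_iff_eulerOrthogonal hle hcd).1
        (h.2 _ (filtered_intervalModule hle (P.symm hab)))).swap_left
  · exact fun h => ⟨isFG_intervalModule, fun V hV => extOrthogonal_of_filtered_left hV
      fun a b hab hP => (extOrthogonal_intervalModule_iff_eulerOrthogonal hab hcd).2 (h a b hP)⟩

theorem EulerOrthogonal.swap_right {m : ℕ} {a b c d : Fin m} (h : EulerOrthogonal a b c d) :
    EulerOrthogonal a b d c := Eq.symm h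

theorem leftPerp_intervalModule_iff {a b : Fin (n + 1)} (hab : a ≤ b) :
    leftPerp (Filtered (intervalModules k (IsArc P))) (intervalModule k n a b) ↔
      leftDual P a b := by
  rw [leftPerp_iff, leftDual_apply]
  constructor
  · intro h c d hcd
    rcases le_total c d with hle | hle
    · exact (extOrthogonal_intervalModule_iff_eulerOrthogonal hab hle).1
        (h.2 _ (filtered_intervalModule hle hcd))
    · exact ((extOrthogonal_intervalModule_iff_eulerOrthogonal hab hle).1
        (h.2 _ (filtered_intervalModule hle (P.symm hcd)))).swap_right
  · exact fun h => ⟨isFG_intervalModule, fun V hV => extOrthogonal_of_filtered_right hV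
      fun c d hcd hP => (extOrthogonal_intervalModule_iff_eulerOrthogonal hab hcd).2 (h c d hP)⟩

variable (k P) in
theorem isThick_rightPerp_filtered :
    IsThick (rightPerp (Filtered (intervalModules k (IsArc P)))) :=
  isThick_rightPerp fun _ hV => hasProjectiveDimensionLT_of_filtered P hV

variable (k P) in
theorem rightPerp_filtered : rightPerp (Filtered (intervalModules k (IsArc P))) =
    Filtered (intervalModules k (IsArc (rightDual P))) :=
  (isThick_rightPerp_filtered k P).eq_filtered fun _ _ hab => (rightPerp_intervalModule_iff hab).symm

variable (k) in
-- Kernels and cokernels of filtered modules are never examined: the subcategory is the right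
-- perpendicular category of the one attached to `leftDual P`.
theorem IsNoncrossing.isThick_filtered (hP : IsNoncrossing P) :
    IsThick (Filtered (intervalModules k (IsArc P))) := by
  have := isThick_rightPerp_filtered k (leftDual P)
  rwa [rightPerp_filtered, hP.rightDual_leftDual] at this

theorem IsNoncrossing.filtered_intervalModule_iff (hP : IsNoncrossing P) {a b : Fin (n + 1)}
    (hab : a ≤ b) :
    Filtered (intervalModules k (IsArc P)) (intervalModule k n a b) ↔ P a b := by
  have := rightPerp_intervalModule_iff (k := k) (P := leftDual P) hab
  rwa [rightPerp_filtered, hP.rightDual_leftDual] at this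

variable (k P) in
-- Both sides are closed under finite direct sums and summands and contain the same interval
-- modules.
theorem leftPerp_filtered :
    leftPerp (Filtered (intervalModules k (IsArc P))) =
      Filtered (intervalModules k (IsArc (leftDual P))) := by
  have hl := isNoncrossing_leftDual P
  have hT := hl.isThick_filtered k
  have h (a b : Fin (n + 1)) (hab : a < b) :
      leftPerp (Filtered (intervalModules k (IsArc P))) (intervalModule k n a b) ↔
      Filtered (intervalModules k (IsArc (leftDual P))) (intervalModule k n a b) := by
    rw [leftPerp_intervalModule_iff hab.le, hl.filtered_intervalModule_iff hab.le]
  apply le_antisymm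
  · exact le_of_intervalModules (fun _ hV => hV.1) (fun _ _ e hX => leftPerp_of_iso e hX)
      (fun _ _ => (leftPerp_biprod_iff _ _).1) (fun _ _ e hX => hX.of_iso e)
      (fun _ => .zero _) (fun _ _ hX hY => (hT.biprod_iff _ _).2 ⟨hX, hY⟩)
      (fun a b hab => (h a b hab).1)
  · exact le_of_intervalModules hT.le_isFG (fun _ _ e hX => hX.of_iso e)
      (fun _ _ => (hT.biprod_iff _ _).1) (fun _ _ e hX => leftPerp_of_iso e hX)
      (fun _ hX => ⟨isFG_of_isZero hX, fun U _ => extOrthogonal_of_isZero_left hX U⟩)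
      (fun _ _ hX hY => (leftPerp_biprod_iff _ _).2 ⟨hX, hY⟩)
      (fun a b hab => (h a b hab).2)

end Perpendicular

/-! ### Simple objects and exceptional subcategories -/

section Simple

variable {P : Setoid (Fin (n + 1))}

theorem not_isZero_intervalModule {a b : Fin (n + 1)} (hab : a < b) :
    ¬ IsZero (intervalModule k n a b) := fun h => by
  have := ModuleCat.subsingleton_of_isZero h
  refine intervalMap_ne_zero (k := k) (le_refl a) hab (le_refl b) ?_
  ext x
  exact Subsingleton.elim _ _

theorem isZero_of_mono_eq_zero {R : Type u} [Ring R] {X Y : ModuleCat.{u} R} {f : X ⟶ Y} [Mono f]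
    (h : f = 0) : IsZero X := by
  rw [IsZero.iff_id_eq_zero, ← cancel_mono f, h]
  simp

/-- A simple object equals its interval summand `[a, b]`, and a related point `c` strictly inside
would give the proper subobject `[a, c]`. Conversely, a nonzero subobject of an arc `[a, b]` has an
interval summand that embeds as `[a, d]` with `d ≤ b`; the arc condition gives `d = b`, and a
nonzero endomorphism of `[a, b]` is surjective. -/
theorem IsThick.isSimpleIn_iff (hC : IsThick C)
    (hP : ∀ a b, a ≤ b → (P a b ↔ C (intervalModule k n a b)))
    (X : ModuleCat.{u} (UpperTriangular k n)) :
    IsSimpleIn C X ↔ intervalModules k (IsArc P) X := by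
  constructor
  · intro hs
    have hX : C X := hs.1
    have : Nontrivial X := by
      by_contra h
      rw [not_nontrivial_iff_subsingleton] at h
      exact hs.not_isZero (ModuleCat.isZero_of_subsingleton X)
    obtain ⟨a, b, hab, M', ⟨e⟩⟩ := exists_iso_biprod X
    have hCab := ((hC.biprod_iff _ _).1 (hC.of_iso e hX)).1
    let f : intervalModule k n a b ⟶ X := biprod.inl ≫ e.inv
    have hf : f ≠ 0 := fun h => not_isZero_intervalModule hab (isZero_of_mono_eq_zero h)
    have := hs.isIso_of_mono hCab f hf
    refine ⟨a, b, ⟨hab, (hP a b hab.le).2 hCab, fun c hac hcb hPc => ?_⟩, ⟨(asIso f).symm⟩⟩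
    let g₀ : intervalModule k n a c ⟶ intervalModule k n a b :=
      ModuleCat.ofHom (intervalMap le_rfl hcb.le)
    have : Mono g₀ := mono_intervalComplex_f hac.le hcb.le (le_refl b)
    let g : intervalModule k n a c ⟶ X := g₀ ≫ f
    have : Mono g := mono_comp _ _
    have hg : g ≠ 0 := fun h => not_isZero_intervalModule hac (isZero_of_mono_eq_zero h)
    have := hs.isIso_of_mono ((hP a c hac.le).1 hPc) g hg
    exact hcb.ne (intervalModule_iso_eq hac hab (asIso g ≪≫ (asIso f).symm)).2
  · rintro ⟨a, b, ⟨hab, hPab, harc⟩, ⟨e⟩⟩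
    have hX : C X := hC.of_iso e.symm ((hP a b hab.le).1 hPab)
    refine hC.isSimpleIn hX (fun h => not_isZero_intervalModule hab (h.of_iso e.symm)) ?_
    intro Y f hY _ hf
    have : Nontrivial Y := by
      by_contra h
      rw [not_nontrivial_iff_subsingleton] at h
      exact hf ((ModuleCat.isZero_of_subsingleton Y).eq_of_src _ _)
    obtain ⟨c, d, hcd, M', ⟨e'⟩⟩ := exists_iso_biprod Y
    have hCcd := ((hC.biprod_iff _ _).1 (hC.of_iso e' hY)).1
    let i : intervalModule k n c d ⟶ Y := biprod.inl ≫ e'.inv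
    let g : intervalModule k n c d ⟶ intervalModule k n a b := i ≫ f ≫ e.hom
    have hg : Mono g := mono_comp _ _
    have hg0 : g.hom ≠ 0 := fun h =>
      not_isZero_intervalModule hcd (isZero_of_mono_eq_zero (f := g) (ModuleCat.hom_ext h))
    obtain ⟨h1, h2, h3⟩ := bounds_of_hom_ne_zero hg0
    obtain rfl := le_antisymm h1 (le_of_hom_injective hcd ((ModuleCat.mono_iff_injective g).1 hg))
    obtain rfl : d = b := by
      by_contra hne
      exact harc d hcd (lt_of_le_of_ne h3 hne) ((hP _ _ hcd.le).2 hCcd)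
    have hepi : Epi g := (ModuleCat.epi_iff_surjective g).2 (surjective_of_hom_ne_zero hg0)
    have : Epi (f ≫ e.hom) := epi_of_epi i (f ≫ e.hom)
    have : f = (f ≫ e.hom) ≫ e.inv := by simp
    rw [this]
    exact epi_comp _ _

/-- Along every arrow between arcs the left end point strictly decreases, so no path returns to its
start. -/
theorem IsThick.isExceptional (hC : IsThick C)
    (hP : ∀ a b, a ≤ b → (P a b ↔ C (intervalModule k n a b))) : IsExceptional C := by
  refine ⟨hC, fun X h => ?_⟩
  have step {T S : ModuleCat.{u} (UpperTriangular k n)} (h : QuiverArrow C T S)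
      {a b : Fin (n + 1)} (hab : a < b) (e : T ≅ intervalModule k n a b) :
      ∃ c d, c < d ∧ c < a ∧ Nonempty (S ≅ intervalModule k n c d) := by
    obtain ⟨-, hS, hext⟩ := h
    obtain ⟨c, d, harc, ⟨e'⟩⟩ := (hC.isSimpleIn_iff hP S).1 hS
    refine ⟨c, d, harc.1, lt_of_nontrivial_ext (k := k) hab.le (d := d) ?_, ⟨e'⟩⟩
    rw [← not_subsingleton_iff_nontrivial] at hext ⊢
    intro hsub
    have := subsingleton_ext_of_iso_left e.symm (intervalModule k n c d) 1
    exact hext (subsingleton_ext_of_iso_right e'.symm T 1)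
  have key {T S : ModuleCat.{u} (UpperTriangular k n)} (h : Relation.TransGen (QuiverArrow C) T S)
      {a b : Fin (n + 1)} (hab : a < b) (e : T ≅ intervalModule k n a b) :
      ∃ c d, c < d ∧ c < a ∧ Nonempty (S ≅ intervalModule k n c d) := by
    induction h with
    | single h => exact step h hab e
    | tail _ h ih =>
      obtain ⟨c, d, hcd, hca, ⟨e'⟩⟩ := ih
      obtain ⟨c', d', hcd', hca', he⟩ := step h hcd e'
      exact ⟨c', d', hcd', hca'.trans hca, he⟩
  have hX : IsSimpleIn C X := by
    cases h with
    | single h => exact h.1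
    | tail _ h => exact h.2.1
  obtain ⟨a, b, harc, ⟨e⟩⟩ := (hC.isSimpleIn_iff hP X).1 hX
  obtain ⟨c, d, hcd, hca, ⟨e'⟩⟩ := key h harc.1 e
  exact hca.ne (intervalModule_iso_eq hcd harc.1 (e'.symm ≪≫ e)).1

end Simple

end ThickSubcategories

/-! ### The poset isomorphism and the duality -/

section Main

variable (k : Type u) [Field k] (n : ℕ)

theorem isExceptional_filtered (P : NC (n + 1)) :
    IsExceptional (Filtered (intervalModules k (IsArc P.1))) :=
  (P.2.isThick_filtered k).isExceptional (P := P.1)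
    fun _ _ hab => (P.2.filtered_intervalModule_iff hab).symm

/-- The isomorphism between the lattice of non-crossing partitions and the poset of exceptional
subcategories of `mod Λ_n`. -/
noncomputable def exceptionalOrderIso :
    NC (n + 1) ≃o ExceptionalSubcategory (UpperTriangular k n) where
  toFun P := ⟨Filtered (intervalModules k (IsArc P.1)), isExceptional_filtered k n P⟩
  invFun C := ⟨C.2.isThick.partition, C.2.isThick.isNoncrossing_partition⟩
  left_inv P := by
    refine Subtype.ext (Setoid.ext fun a b => ?_)
    have hT := P.2.isThick_filtered k
    have key (a b : Fin (n + 1)) (hab : a ≤ b) : hT.partition a b ↔ P.1 a b := by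
      rw [hT.partition_iff hab, P.2.filtered_intervalModule_iff hab]
    rcases le_total a b with hab | hab
    · exact key a b hab
    · exact ⟨fun h => P.1.symm ((key b a hab).1 (Setoid.symm' _ h)),
        fun h => Setoid.symm' _ ((key b a hab).2 (P.1.symm h))⟩
  right_inv C := Subtype.ext
    (C.2.isThick.eq_filtered fun _ _ hab => C.2.isThick.partition_iff hab).symm
  map_rel_iff' {P P'} := by
    constructor
    · intro h
      have key (a b : Fin (n + 1)) (hab : a ≤ b) (hP : P.1 a b) : P'.1 a b :=
        (P'.2.filtered_intervalModule_iff hab).1 (h _ (filtered_intervalModule (k := k) hab hP))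
      intro a b hP
      rcases le_total a b with hab | hab
      · exact key a b hab hP
      · exact P'.1.symm (key b a hab (P.1.symm hP))
    · intro h
      refine (P'.2.isThick_filtered k).filtered_le ?_
      rintro X ⟨a, b, harc, ⟨e⟩⟩
      exact (filtered_intervalModule harc.1.le (h harc.2.1)).of_iso e.symm

end Main

/-- Let `A` be the identification of the non-crossing partitions with the exceptional subcategories
of `mod Λ_n` by means of arcs, let `δ` be the anti-automorphism given by the right perpendicular
category and `κ` the Kreweras complement. Then `δ ∘ A = A ∘ κ`. Here, the simple objects of `A P` are
the arcs of `P` and the simple objects of `^⊥(A P)` are the coarcs of `P`. -/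
theorem theorem4p3 (k : Type u) [Field k] (n : ℕ) :
    ∃ (A : NC (n + 1) ≃o ExceptionalSubcategory (UpperTriangular k n))
      (δ : ExceptionalSubcategory (UpperTriangular k n) ≃o
        (ExceptionalSubcategory (UpperTriangular k n))ᵒᵈ)
      (κ : NC (n + 1) → NC (n + 1)),
      (∀ P, (A P).1 = Filtered (intervalModules k (IsArc P.1))) ∧
      (∀ P X, IsSimpleIn (A P).1 X ↔ intervalModules k (IsArc P.1) X) ∧
      (∀ C, (OrderDual.ofDual (δ C)).1 = rightPerp C.1) ∧
      (∀ P, (κ P).1 = krewerasComplement P.1) ∧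
      (∀ P, OrderDual.ofDual (δ (A P)) = A (κ P)) ∧
      (∀ P X, IsSimpleIn (leftPerp (A P).1) X ↔ intervalModules k (IsCoarc P.1) X) := by
  let A := exceptionalOrderIso k n
  let κ : NC (n + 1) → NC (n + 1) := fun P => OrderDual.ofDual (rightDualOrderIso (n + 1) P)
  -- The Kreweras anti-automorphism is transported along `A`, so bijectivity and order reversal come
  -- for free; `rightPerp_filtered` then identifies the result with the right perpendicular
  -- category.
  let δ := A.symm.trans ((rightDualOrderIso (n + 1)).trans A.dual)
  have hδ (P) : OrderDual.ofDual (δ (A P)) = A (κ P) := by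
    change A (OrderDual.ofDual (rightDualOrderIso (n + 1) (A.symm (A P)))) = _
    rw [A.symm_apply_apply]
  refine ⟨A, δ, κ, fun P => rfl, fun P X => ?_, fun C => ?_, fun P => P.2.krewerasComplement_eq.symm,
    hδ, fun P X => ?_⟩
  · exact (P.2.isThick_filtered k).isSimpleIn_iff
      (fun _ _ hab => (P.2.filtered_intervalModule_iff hab).symm) X
  · obtain ⟨P, rfl⟩ := A.surjective C
    rw [hδ]
    exact (rightPerp_filtered k P.1).symm
  · change IsSimpleIn (leftPerp (Filtered (intervalModules k (IsArc P.1)))) X ↔ _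
    have hl := isNoncrossing_leftDual P.1
    rw [leftPerp_filtered k P.1, (hl.isThick_filtered k).isSimpleIn_iff
      (fun _ _ hab => (hl.filtered_intervalModule_iff hab).symm) X]
    simp only [intervalModules, P.2.isArc_leftDual_iff]
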